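/- Let $r\ge 1$, let $[\alpha_i]\in(0,1]^r$ with $\sum_i\alpha_i=1$, and let $[p_{ij}]\in[0,1]^{r\times r}$ be symmetric. The stochastic partitioned graph $G(n,[\alpha_i],[p_{ij}])$ is the random graph on $n$ vertices partitioned as $V=V_1\sqcup\dots\sqcup V_r$ with $|V_i|=\alpha_i n$, in which every pair $u\in V_i$, $v\in V_j$, $u\ne v$, is an edge with probability $p_{ij}$, independently. For a graph $G=(V,E)$, couplings $\beta=[\beta_{uv}]_{uv\in E}$ and external fields $\gamma=[\gamma_v]_{v\in V}$, the Ising model is the distribution $\mu(\sigma)\propto\exp\big(\sum_{uv\in E}\beta_{uv}\sigma_u\sigma_v+\sum_{v\in V}\gamma_v\sigma_v\big)$ on $\{-1,1\}^V$; it is ferromagnetic if all $\beta_{uv}\ge 0$. One step of the Swendsen-Wang chain from $X_t$ takes the set of edges $uv\in E$ with $X_t(u)=X_t(v)$, keeps each of them independently with probability $1-e^{-2\beta_{uv}}$, and then lets each connected component $C$ of the graph on $V$ formed by the kept edges independently choose the spin $+1$ with probability $e^{2\Gamma_C}/(1+e^{2\Gamma_C})$, where $\Gamma_C=\sum_{v\in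 C}\gamma_v$, and the spin $-1$ otherwise; all vertices of $C$ get that spin in $X_{t+1}$. Its mixing time $T_{\mathrm{mix}}$ is the least $t$ such that $|\Pr(X_t\in A)-\mu(A)|\le \frac14$ for all starting states $X_0$ and all $A\subseteq\{-1,1\}^V$. Theorem. For all constants $\alpha_0,p_0,\beta_0>0$ there are constants $C,c>0$, depending only on $\alpha_0,p_0,\beta_0$, such that for all $n\ge 2$ and all $r$, $[\alpha_i]$, $[p_{ij}]$ as above (with every $\alpha_i n$ an integer) with $\alpha_i\ge\alpha_0$ for all $i$, the following holds in each of these two cases: (a) $p_{ii}\ge p_0$ for all $i$; (b) $r\ge 2$ and $p_{ij}\ge p_0$ for all $i\ne j$. With probability at least $1-e^{-cn}$ over the choice of the graph $G\sim G(n,[\alpha_i],[p_{ij}])$, the Swendsen-Wang chain satisfies $T_{\mathrm{mix}}\le C\log n$ for every ferromagnetic Ising model on $G$ such that $\gamma_v\ge 0$ for all $v$ or $\gamma_v\le 0$ for all $v$, and such that $\beta_{uv}\ge\beta_0$ for all edges $uv$ inside a part (in case (a)), respectively for all edges $uv$ between two different parts (in case (b)). -/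

import Mathlib

namespace SwendsenWang

noncomputable section

/-! ### Ising model

A spin configuration on `V` is a map `σ : V → Bool`, where `true` is the spin `+1` and `false` is
the spin `-1`.  Functions on unordered pairs `Sym2 V` hold the couplings `β`; only their values on
the edges of the graph are ever used. -/

/-- The numerical value of a spin. -/
def spin (b : Bool) : ℝ := if b then 1 else -1

open Classical in
/-- The unnormalised Ising weight
`exp (∑_{uv ∈ E} β_uv σ_u σ_v + ∑_v γ_v σ_v)`. -/
def isingWeight {V : Type*} [Fintype V] (G : SimpleGraph V) (β : Sym2 V → ℝ) (γ : V → ℝ)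
    (σ : V → Bool) : ℝ :=
  Real.exp (∑ e ∈ G.edgeFinset, β e * (e.map (fun v => spin (σ v))).mul
    + ∑ v, γ v * spin (σ v))

open Classical in
/-- The Ising (Gibbs) distribution `μ`. -/
def isingMeasure {V : Type*} [Fintype V] (G : SimpleGraph V) (β : Sym2 V → ℝ) (γ : V → ℝ)
    (σ : V → Bool) : ℝ :=
  isingWeight G β γ σ / ∑ τ : V → Bool, isingWeight G β γ τ

/-! ### Swendsen-Wang dynamics -/

open Classical in
/-- The set of monochromatic edges of `G` in the configuration `σ`. -/
def monoEdges {V : Type*} [Fintype V] (G : SimpleGraph V) (σ : V → Bool) : Finset (Sym2 V) :=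
  G.edgeFinset.filter (fun e => (e.map σ).IsDiag)

open Classical in
/-- The probability that the percolation step, run on the edge set `M`, keeps exactly the edges in
`M' ⊆ M`: each edge `e` is kept independently with probability `1 - exp (-2 β_e)`. -/
def percolationProb {V : Type*} (β : Sym2 V → ℝ) (M M' : Finset (Sym2 V)) : ℝ :=
  (∏ e ∈ M', (1 - Real.exp (-2 * β e))) * ∏ e ∈ M \ M', Real.exp (-2 * β e)

open Classical in
/-- The probability that a connected component `C` chooses the spin `b`. -/
def componentSpinProb {V : Type*} [Fintype V] {H : SimpleGraph V} (γ : V → ℝ)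
    (C : H.ConnectedComponent) (b : Bool) : ℝ :=
  if b then
    Real.exp (2 * ∑ v with H.connectedComponentMk v = C, γ v) /
      (1 + Real.exp (2 * ∑ v with H.connectedComponentMk v = C, γ v))
  else
    1 / (1 + Real.exp (2 * ∑ v with H.connectedComponentMk v = C, γ v))

open Classical in
/-- The probability that the configuration `τ` results when the connected components of `H`
choose their spins independently. -/
def coloringProb {V : Type*} [Fintype V] (H : SimpleGraph V) (γ : V → ℝ) (τ : V → Bool) : ℝ :=
  ∑ s : H.ConnectedComponent → Bool,
    if (fun v => s (H.connectedComponentMk v)) = τ then ∏ C, componentSpinProb γ C (s C) else 0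

open Classical in
/-- The transition matrix of the Swendsen-Wang chain for the Ising model on `G`. -/
def transition {V : Type*} [Fintype V] (G : SimpleGraph V) (β : Sym2 V → ℝ) (γ : V → ℝ) :
    Matrix (V → Bool) (V → Bool) ℝ :=
  Matrix.of fun σ τ => ∑ M' ∈ (monoEdges G σ).powerset,
    percolationProb β (monoEdges G σ) M' *
      coloringProb (SimpleGraph.fromEdgeSet (M' : Set (Sym2 V))) γ τ

open Classical in
/-- `Pr (X_t ∈ A)` for the Swendsen-Wang chain started at `X_0 = σ`. -/
def probAt {V : Type*} [Fintype V] (G : SimpleGraph V) (β : Sym2 V → ℝ) (γ : V → ℝ)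
    (t : ℕ) (σ : V → Bool) (A : Finset (V → Bool)) : ℝ :=
  ∑ τ ∈ A, (transition G β γ ^ t) σ τ

/-- `T` is the mixing time of the Swendsen-Wang chain: the least `t` such that
`|Pr (X_t ∈ A) - μ (A)| ≤ 1/4` for all starting states `X_0` and all sets `A` of states. -/
def IsMixingTime {V : Type*} [Fintype V] (G : SimpleGraph V) (β : Sym2 V → ℝ) (γ : V → ℝ)
    (T : ℕ) : Prop :=
  IsLeast {t : ℕ | ∀ (σ : V → Bool) (A : Finset (V → Bool)),
    |probAt G β γ t σ A - ∑ τ ∈ A, isingMeasure G β γ τ| ≤ 1 / 4} T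

/-! ### Stochastic partitioned random graphs

The parts are the fibres of `part : V → Fin r`.  The symmetric matrix `[p_ij]` is a function `p` on
unordered pairs of indices, so `p_ij` is `p s(i, j)`. -/

open Classical in
/-- The probability of the graph `G` in the random graph model in which the pair `{u, v}`,
`u ≠ v`, is an edge with probability `p_ij`, independently over pairs, where `i` and `j` are the
parts of `u` and `v`. -/
def graphWeight {V : Type*} [Fintype V] {r : ℕ} (part : V → Fin r) (p : Sym2 (Fin r) → ℝ)
    (G : SimpleGraph V) : ℝ :=
  ∏ e : Sym2 V with ¬ e.IsDiag, if e ∈ G.edgeSet then p (e.map part) else 1 - p (e.map part)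

open Classical in
/-- The probability that the stochastic partitioned random graph has the property `Q`. -/
def graphProb {V : Type*} [Fintype V] {r : ℕ} (part : V → Fin r) (p : Sym2 (Fin r) → ℝ)
    (Q : SimpleGraph V → Prop) : ℝ :=
  ∑ G : SimpleGraph V with Q G, graphWeight part p G

/-- All external fields have one sign. -/
def SameSign {V : Type*} (γ : V → ℝ) : Prop := (∀ v, 0 ≤ γ v) ∨ (∀ v, γ v ≤ 0)

/-- For every ferromagnetic choice of couplings with `β_uv ≥ b` on all edges whose pair of parts
satisfies `S`, and all external fields of one sign, the mixing time of the Swendsen-Wang chain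
on `G` is at most `B`. -/
def MixesWithin {V : Type*} [Fintype V] {r : ℕ} (part : V → Fin r)
    (S : Sym2 (Fin r) → Prop) (b B : ℝ) (G : SimpleGraph V) : Prop :=
  ∀ (β : Sym2 V → ℝ) (γ : V → ℝ),
    (∀ e ∈ G.edgeSet, 0 ≤ β e) →
    (∀ e ∈ G.edgeSet, S (e.map part) → b ≤ β e) →
    SameSign γ →
    ∃ T : ℕ, IsMixingTime G β γ T ∧ (T : ℝ) ≤ B

end

end SwendsenWang

namespace SwendsenWang

/-! The proof is a Doeblin minorisation. Fields of one sign favour a spin z: every cluster takes z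
with probability at least 1/2, and the hitting bounds use nothing else about the fields. If from
every start the all-z configuration has probability at least a constant q after t = O(log n) steps,
then a constant number of rounds of t steps mixes the chain (`exists_isMixingTime_le`). Stationarity
of the Ising measure comes from reversibility (`isingWeight_mul_transition`).

How all-z is reached: whatever the percolation does, one step leaves a constant fraction of z in
every part with constant probability (`le_transition_rich`). Let B be the set of z-vertices. On a
typical graph only few vertices L have low degree into B. Starting from the monochromatic set B \ L,
the agreeing set X contains linearly many vertices of each part and has linear minimum degree, so
each cut of X inside a block has linearly many edges per vertex of its smaller side
(`GoodGraph.robust`). Percolation then joins the agreeing vertices of each block except with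
exponentially small probability (`percProbOf_not_joins_le`). Any other vertex disagrees after
recolouring with probability at most 1/2 (`colorExp_ne_le`), so the expected number of disagreements
halves in each step (`le_pow_transition_constant`). About log₂ n steps absorb the complement of L,
as many again absorb L, and one last step turns all blocks to z.

A block is a union of parts within which strong couplings connect the vertices: a single part in
case (a), everything in case (b). The graph properties needed, collected in `GoodGraph`, follow from
a Chernoff bound and a union bound over 4^n pairs of sets with order n² relevant pairs and over n
stars (`one_sub_le_graphProb_goodGraph`). They are fixed before β and γ are chosen, so one event
serves all Ising models at once. -/

open Classical in
/-- The indicator of a proposition. -/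
noncomputable def ind (p : Prop) : ℝ := if p then 1 else 0

theorem ind_of {p : Prop} (h : p) : ind p = 1 := if_pos h

theorem ind_of_not {p : Prop} (h : ¬ p) : ind p = 0 := if_neg h

theorem ind_nonneg (p : Prop) : 0 ≤ ind p := by
  unfold ind; split_ifs <;> simp

theorem ind_mono {p q : Prop} (h : p → q) : ind p ≤ ind q := by
  by_cases hp : p
  · rw [ind_of hp, ind_of (h hp)]
  · rw [ind_of_not hp]; exact ind_nonneg q

theorem ite_eq_ind (p : Prop) [Decidable p] : (if p then (1 : ℝ) else 0) = ind p := by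
  unfold ind; congr

theorem sum_ind {κ : Type*} (A : Finset κ) (p : κ → Prop) [DecidablePred p] :
    ∑ k ∈ A, ind (p k) = (A.filter p).card := by
  rw [Finset.card_filter]
  push_cast
  exact Finset.sum_congr rfl fun k _ => (ite_eq_ind (p k)).symm

theorem prod_ind {κ : Type*} (A : Finset κ) (p : κ → Prop) :
    ∏ k ∈ A, ind (p k) = ind (∀ k ∈ A, p k) := by
  classical
  simp only [← ite_eq_ind]
  rw [Finset.prod_ite_zero]
  simp

/-! ### Random spins of the components -/

open Classical in
theorem sum_componentSpinProb {V : Type*} [Fintype V] {H : SimpleGraph V} (γ : V → ℝ)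
    (C : H.ConnectedComponent) : ∑ b : Bool, componentSpinProb γ C b = 1 := by
  simp only [Fintype.sum_bool, componentSpinProb]
  simp only [if_true, Bool.false_eq_true, if_false]
  rw [← add_div, add_comm, div_self]
  positivity

theorem componentSpinProb_nonneg {V : Type*} [Fintype V] {H : SimpleGraph V} (γ : V → ℝ)
    (C : H.ConnectedComponent) (b : Bool) : 0 ≤ componentSpinProb γ C b := by
  unfold componentSpinProb
  split_ifs <;> positivity

/-- The spin `b` is at least as likely as its opposite in every component of every graph. -/
def Favours {V : Type*} [Fintype V] (γ : V → ℝ) (b : Bool) : Prop :=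
  ∀ (H : SimpleGraph V) (C : H.ConnectedComponent), 1 / 2 ≤ componentSpinProb γ C b

theorem SameSign.exists_favours {V : Type*} [Fintype V] {γ : V → ℝ} (h : SameSign γ) :
    ∃ b, Favours γ b := by
  classical
  rcases h with h | h
  · refine ⟨true, fun H C => ?_⟩
    simp only [componentSpinProb, if_true]
    have h1 : 1 ≤ Real.exp (2 * ∑ v with H.connectedComponentMk v = C, γ v) := by
      apply Real.one_le_exp
      have := Finset.sum_nonneg (s := Finset.univ.filter
        (fun v => H.connectedComponentMk v = C)) (fun v _ => h v)
      positivity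
    rw [div_le_div_iff₀ (by norm_num) (by positivity)]
    convert_to 1 * (1 + Real.exp (2 * ∑ v with H.connectedComponentMk v = C, γ v)) ≤
      Real.exp (2 * ∑ v with H.connectedComponentMk v = C, γ v) * 2
    linarith
  · refine ⟨false, fun H C => ?_⟩
    simp only [componentSpinProb, Bool.false_eq_true, if_false]
    have h1 : Real.exp (2 * ∑ v with H.connectedComponentMk v = C, γ v) ≤ 1 := by
      apply Real.exp_le_one_iff.2
      have := Finset.sum_nonpos (s := Finset.univ.filter
        (fun v => H.connectedComponentMk v = C)) (fun v _ => h v)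
      linarith
    rw [div_le_div_iff₀ (by norm_num) (by positivity)]
    convert_to 1 * (1 + Real.exp (2 * ∑ v with H.connectedComponentMk v = C, γ v)) ≤ 1 * 2
    linarith

open Classical in
/-- The probability that the connected components of `H` choose the spins `s`. -/
noncomputable def colorWeight {V : Type*} [Fintype V] {H : SimpleGraph V} (γ : V → ℝ)
    (s : H.ConnectedComponent → Bool) : ℝ :=
  ∏ C, componentSpinProb γ C (s C)

theorem colorWeight_nonneg {V : Type*} [Fintype V] {H : SimpleGraph V} (γ : V → ℝ)
    (s : H.ConnectedComponent → Bool) : 0 ≤ colorWeight γ s :=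
  Finset.prod_nonneg fun _ _ => componentSpinProb_nonneg _ _ _

open Classical in
/-- The expectation of `f` when the connected components of `H` choose their spins. -/
noncomputable def colorExp {V : Type*} [Fintype V] (H : SimpleGraph V) (γ : V → ℝ)
    (f : (V → Bool) → ℝ) : ℝ :=
  ∑ s : H.ConnectedComponent → Bool,
    colorWeight γ s * f (fun v => s (H.connectedComponentMk v))

open Classical in
theorem sum_coloringProb_mul {V : Type*} [Fintype V] (H : SimpleGraph V) (γ : V → ℝ)
    (f : (V → Bool) → ℝ) :
    ∑ τ, coloringProb H γ τ * f τ =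
colorExp H γ f := by
  simp only [colorExp, coloringProb, Finset.sum_mul]
  rw [Finset.sum_comm]
  refine Finset.sum_congr rfl fun s _ => ?_
  simp only [ite_mul, zero_mul, Finset.sum_ite_eq, Finset.mem_univ, if_true, colorWeight]

open Classical in
-- Independence of the component spins: the sum over s of a product is a product of sums, and each
-- component outside D contributes total mass 1.
theorem sum_colorWeight_forall {V : Type*} [Fintype V] {H : SimpleGraph V} (γ : V → ℝ)
    (D : Finset H.ConnectedComponent) (a : H.ConnectedComponent → Bool) :
    ∑ s : H.ConnectedComponent → Bool,
      colorWeight γ s * (if ∀ C ∈ D, s C = a C then 1 else 0) =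
      ∏ C ∈ D, componentSpinProb γ C (a C) := by
  have h1 : ∀ s : H.ConnectedComponent → Bool,
      colorWeight γ s * (if ∀ C ∈ D, s C = a C then 1 else 0) =
      ∏ C, componentSpinProb γ C (s C) * (if C ∈ D → s C = a C then 1 else 0) := by
    intro s
    rw [Finset.prod_mul_distrib, colorWeight]
    congr 1
    rw [Finset.prod_ite_zero]
    simp
  rw [Finset.sum_congr rfl fun s _ => h1 s]
  have h2 := Finset.prod_univ_sum (fun _ : H.ConnectedComponent => (Finset.univ : Finset Bool))
    (fun C x => componentSpinProb γ C x * (if C ∈ D → x = a C then 1 else 0))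
  rw [Fintype.piFinset_univ] at h2
  rw [← h2, ← Finset.prod_subset (Finset.subset_univ D)]
  · refine Finset.prod_congr rfl fun C hC => ?_
    simp [hC]
  · intro C _ hC
    simpa [hC] using sum_componentSpinProb γ C

open Classical in
theorem colorExp_const {V : Type*} [Fintype V] (H : SimpleGraph V) (γ : V → ℝ) (a : ℝ) :
    colorExp H γ (fun _ => a) = a := by
  rw [colorExp, ← Finset.sum_mul]
  simpa using congrArg (· * a) <| sum_colorWeight_forall (H := H) γ ∅ (fun _ => true)

theorem colorExp_mono {V : Type*} [Fintype V] {H : SimpleGraph V} {γ : V → ℝ}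
    {f g : (V → Bool) → ℝ}
    (h : ∀ τ : V → Bool, (∀ u v, H.Reachable u v → τ u = τ v) → f τ ≤ g τ) :
    colorExp H γ f ≤ colorExp H γ g := by
  refine Finset.sum_le_sum fun s _ => mul_le_mul_of_nonneg_left (h _ fun u v huv => ?_)
    (colorWeight_nonneg γ s)
  simp only [SimpleGraph.ConnectedComponent.sound huv]

theorem colorExp_sum {V κ : Type*} [Fintype V] (H : SimpleGraph V) (γ : V → ℝ)
    (A : Finset κ) (f : κ → (V → Bool) → ℝ) :
    colorExp H γ (fun τ => ∑ k ∈ A, f k τ) = ∑ k ∈ A, colorExp H γ (f k) := by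
  simp only [colorExp, Finset.mul_sum]
  exact Finset.sum_comm

open Classical in
-- The chosen vertices meet at most |ι| components, each of which takes the favoured spin with
-- probability at least 1/2; coincidences among components only help.
theorem le_colorExp_forall {V ι : Type*} [Fintype V] [Fintype ι] (H : SimpleGraph V)
    {γ : V → ℝ} {b : Bool} (hb : Favours γ b) (c : ι → V) :
    (1 / 2 : ℝ) ^ Fintype.card ι ≤ 
      colorExp H γ (fun τ => ind (∀ i, τ (c i) = b)) := by
  simp only [← ite_eq_ind]
  rw [colorExp]
  have h := sum_colorWeight_forall (H := H) γ
    (Finset.univ.image fun i => H.connectedComponentMk (c i)) (fun _ => b)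
  simp only [Finset.mem_image, Finset.mem_univ, true_and, forall_exists_index,
    forall_apply_eq_imp_iff] at h
  rw [h]
  calc (1 / 2 : ℝ) ^ Fintype.card ι
      ≤ (1 / 2 : ℝ) ^ (Finset.univ.image fun i => H.connectedComponentMk (c i)).card := by
        apply pow_le_pow_of_le_one (by norm_num) (by norm_num)
        exact Finset.card_image_le.trans (by simp)
    _ ≤ _ := by
        rw [← Finset.prod_const]
        exact Finset.prod_le_prod (fun _ _ => by norm_num) fun C _ => hb H C

open Classical in
-- If two independent components take the favoured spin with probabilities x, y ≥ 1/2, they differ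
-- with probability x + y - 2xy, which is 1/2 - 2(x - 1/2)(y - 1/2). This is where the fields must
-- have one sign.
theorem colorExp_ne_le {V : Type*} [Fintype V] (H : SimpleGraph V)
    {γ : V → ℝ} {b : Bool} (hb : Favours γ b) (u v : V) :
    colorExp H γ (fun τ => ind (τ u ≠ τ v)) ≤ 1 / 2 := by
  simp only [← ite_eq_ind]
  rw [colorExp]
  set C := H.connectedComponentMk u
  set D := H.connectedComponentMk v
  change ∑ s : H.ConnectedComponent → Bool,
    colorWeight γ s * (if s C ≠ s D then 1 else 0) ≤ 1 / 2
  by_cases hCD : C = D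
  · simp [hCD]
  have key : ∀ x y : Bool, ∑ s : H.ConnectedComponent → Bool,
      colorWeight γ s * (if s C = x ∧ s D = y then 1 else 0) =
      componentSpinProb γ C x * componentSpinProb γ D y := by
    intro x y
    have h := sum_colorWeight_forall (H := H) γ {C, D} (fun E => if E = C then x else y)
    rw [Finset.prod_pair hCD] at h
    simpa [Ne.symm hCD] using h
  have hs : ∀ s : H.ConnectedComponent → Bool, colorWeight γ s * (if s C ≠ s D then 1 else 0) =
      colorWeight γ s * (if s C = b ∧ s D = !b then 1 else 0) +
      colorWeight γ s * (if s C = !b ∧ s D = b then 1 else 0) := by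
    intro s
    cases s C <;> cases s D <;> cases b <;> simp
  rw [Finset.sum_congr rfl fun s _ => hs s, Finset.sum_add_distrib, key, key]
  have e1 := sum_componentSpinProb γ C
  have e2 := sum_componentSpinProb γ D
  have f1 := hb H C
  have f2 := hb H D
  have e1' : componentSpinProb γ C (!b) = 1 - componentSpinProb γ C b := by
    rw [Fintype.sum_bool] at e1; cases b <;> simp <;> linarith
  have e2' : componentSpinProb γ D (!b) = 1 - componentSpinProb γ D b := by
    rw [Fintype.sum_bool] at e2; cases b <;> simp <;> linarith
  rw [e1', e2']
  nlinarith [mul_nonneg (sub_nonneg.2 f1) (sub_nonneg.2 f2)]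

/-! ### Percolation -/

theorem percolationProb_nonneg {V : Type*} {β : Sym2 V → ℝ} {M M' : Finset (Sym2 V)}
    (hβ : ∀ e ∈ M, 0 ≤ β e) (h : M' ⊆ M) : 0 ≤ percolationProb β M M' := by
  refine mul_nonneg (Finset.prod_nonneg fun e he => ?_)
    (Finset.prod_nonneg fun e _ => (Real.exp_pos _).le)
  have := hβ e (h he)
  rw [sub_nonneg, Real.exp_le_one_iff]
  linarith

open Classical in
theorem sum_percolationProb_disjoint {V : Type*} (β : Sym2 V → ℝ) {M F : Finset (Sym2 V)}
    (hF : F ⊆ M) :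
    ∑ M' ∈ M.powerset, percolationProb β M M' * ind (Disjoint M' F) =
      ∏ e ∈ F, Real.exp (-2 * β e) := by
  simp only [← ite_eq_ind]
  -- Giving weight 0 to keeping an edge of F makes the expansion of the product run only over the
  -- kept sets disjoint from F.
  have h := Finset.prod_add (fun e => if e ∉ F then 1 - Real.exp (-2 * β e) else 0)
    (fun e => Real.exp (-2 * β e)) M
  have h2 : ∏ e ∈ M, ((if e ∉ F then 1 - Real.exp (-2 * β e) else 0) + Real.exp (-2 * β e)) =
      ∏ e ∈ F, Real.exp (-2 * β e) := by
    rw [← Finset.prod_subset hF]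
    · refine Finset.prod_congr rfl fun e he => by simp [he]
    · intro e _ he
      simp [he]
  rw [← h2, h]
  refine Finset.sum_congr rfl fun t _ => ?_
  rw [Finset.prod_ite_zero, percolationProb]
  simp only [Finset.disjoint_left]
  split_ifs <;> simp

theorem sum_percolationProb {V : Type*} (β : Sym2 V → ℝ) (M : Finset (Sym2 V)) :
    ∑ M' ∈ M.powerset, percolationProb β M M' = 1 := by
  simpa [ind] using sum_percolationProb_disjoint β (Finset.empty_subset M)

open Classical in
/-- The expectation of `f` after one step of the chain, in terms of the edges kept and the spins
chosen by the components. -/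
theorem sum_transition_mul {V : Type*} [Fintype V] (G : SimpleGraph V) (β : Sym2 V → ℝ)
    (γ : V → ℝ) (σ : V → Bool) (f : (V → Bool) → ℝ) :
    ∑ τ, transition G β γ σ τ * f τ =
      ∑ M' ∈ (monoEdges G σ).powerset, percolationProb β (monoEdges G σ) M' *
        colorExp (SimpleGraph.fromEdgeSet (M' : Set (Sym2 V))) γ f := by
  simp only [transition, Matrix.of_apply, Finset.sum_mul]
  rw [Finset.sum_comm]
  refine Finset.sum_congr rfl fun M' _ => ?_
  rw [← sum_coloringProb_mul, Finset.mul_sum]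
  exact Finset.sum_congr rfl fun τ _ => mul_assoc _ _ _

theorem coloringProb_nonneg {V : Type*} [Fintype V] (H : SimpleGraph V) (γ : V → ℝ)
    (τ : V → Bool) : 0 ≤ coloringProb H γ τ := by
  refine Finset.sum_nonneg fun s _ => ?_
  split_ifs
  · exact colorWeight_nonneg γ s
  · exact le_rfl

/-- The couplings are nonnegative on all edges. -/
def Ferromagnetic {V : Type*} (G : SimpleGraph V) (β : Sym2 V → ℝ) : Prop :=
  ∀ e ∈ G.edgeSet, 0 ≤ β e

theorem Ferromagnetic.monoEdges {V : Type*} [Fintype V] {G : SimpleGraph V} {β : Sym2 V → ℝ}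
    (hβ : Ferromagnetic G β) (σ : V → Bool) : ∀ e ∈ monoEdges G σ, 0 ≤ β e := by
  classical
  intro e he
  exact hβ e (by simpa using (Finset.mem_filter.1 he).1)

theorem transition_nonneg {V : Type*} [Fintype V] {G : SimpleGraph V} {β : Sym2 V → ℝ}
    (hβ : Ferromagnetic G β) (γ : V → ℝ) (σ τ : V → Bool) : 0 ≤ transition G β γ σ τ :=
  Finset.sum_nonneg fun _ hM => mul_nonneg
    (percolationProb_nonneg (hβ.monoEdges σ) (Finset.mem_powerset.1 hM))
    (coloringProb_nonneg _ _ _)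

open Classical in
theorem sum_transition {V : Type*} [Fintype V] (G : SimpleGraph V) (β : Sym2 V → ℝ)
    (γ : V → ℝ) (σ : V → Bool) : ∑ τ, transition G β γ σ τ = 1 := by
  have h := sum_transition_mul G β γ σ (fun _ => 1)
  simpa only [mul_one, colorExp_const, sum_percolationProb] using h
open Matrix

/-! ### Doeblin contraction for finite Markov chains -/

/-- All rows share mass q at z, so one application of P sends values in an interval of length l to
values in an interval of length (1 - q) l. -/
theorem exists_le_mulVec_le {ι : Type*} [Fintype ι] [DecidableEq ι] {P : Matrix ι ι ℝ}
    (h0 : ∀ x y, 0 ≤ P x y) (h1 : ∀ x, ∑ y, P x y = 1) {q : ℝ} {z : ι} (hq : ∀ x, q ≤ P x z)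
    {f : ι → ℝ} (hf : ∀ x, 0 ≤ f x ∧ f x ≤ 1) (k : ℕ) :
    ∃ a, ∀ x, a ≤ (P ^ k *ᵥ f) x ∧ (P ^ k *ᵥ f) x ≤ a + (1 - q) ^ k := by
  induction k with
  | zero => exact ⟨0, by simpa using hf⟩
  | succ k ih =>
    obtain ⟨a, ha⟩ := ih
    rw [pow_succ', ← mulVec_mulVec]
    set g := P ^ k *ᵥ f
    have key : ∀ (x : ι) (h : ι → ℝ), (∀ y, 0 ≤ h y) → q * h z ≤ ∑ y, P x y * h y := by
      intro x h hh
      calc q * h z ≤ P x z * h z := mul_le_mul_of_nonneg_right (hq x) (hh z)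
        _ ≤ _ := Finset.single_le_sum (f := fun y => P x y * h y)
          (fun y _ => mul_nonneg (h0 x y) (hh y)) (Finset.mem_univ z)
    refine ⟨q * g z + (1 - q) * a, fun x => ⟨?_, ?_⟩⟩
    · have := key x (fun y => g y - a) (fun y => sub_nonneg.2 (ha y).1)
      simp only [mul_sub, Finset.sum_sub_distrib, ← Finset.sum_mul, h1] at this
      rw [mulVec, dotProduct]
      linarith
    · have := key x (fun y => a + (1 - q) ^ k - g y) (fun y => sub_nonneg.2 (ha y).2)
      simp only [mul_sub, Finset.sum_sub_distrib, ← Finset.sum_mul, h1] at this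
      rw [mulVec, dotProduct, pow_succ]
      linarith

theorem abs_mulVec_sub_le {ι : Type*} [Fintype ι] [DecidableEq ι] {P : Matrix ι ι ℝ}
    (h0 : ∀ x y, 0 ≤ P x y) (h1 : ∀ x, ∑ y, P x y = 1) {q : ℝ} {z : ι} (hq : ∀ x, q ≤ P x z)
    {μ : ι → ℝ} (hμ0 : ∀ x, 0 ≤ μ x) (hμ1 : ∑ x, μ x = 1) (hμ : μ ᵥ* P = μ)
    {f : ι → ℝ} (hf : ∀ x, 0 ≤ f x ∧ f x ≤ 1) (k : ℕ) (x : ι) :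
    |(P ^ k *ᵥ f) x - μ ⬝ᵥ f| ≤ (1 - q) ^ k := by
  obtain ⟨a, ha⟩ := exists_le_mulVec_le h0 h1 hq hf k
  have hk : ∀ k, μ ᵥ* P ^ k = μ := by
    intro k
    induction k with
    | zero => simp
    | succ k ih => rw [pow_succ, ← vecMul_vecMul, ih, hμ]
  have e : μ ⬝ᵥ f = ∑ y, μ y * (P ^ k *ᵥ f) y := by
    conv_lhs => rw [← hk k, ← dotProduct_mulVec]
    rfl
  have l : a ≤ μ ⬝ᵥ f := by
    calc a = ∑ y, μ y * a := by rw [← Finset.sum_mul, hμ1, one_mul]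
      _ ≤ _ := by
        rw [e]; exact Finset.sum_le_sum fun y _ => mul_le_mul_of_nonneg_left (ha y).1 (hμ0 y)
  have u : μ ⬝ᵥ f ≤ a + (1 - q) ^ k := by
    calc _ ≤ ∑ y, μ y * (a + (1 - q) ^ k) := by
          rw [e]; exact Finset.sum_le_sum fun y _ => mul_le_mul_of_nonneg_left (ha y).2 (hμ0 y)
      _ = _ := by rw [← Finset.sum_mul, hμ1, one_mul]
  rw [abs_le]
  constructor <;> linarith [(ha x).1, (ha x).2]

/-! ### Reversibility -/

open Classical in
theorem mem_monoEdges {V : Type*} [Fintype V] {G : SimpleGraph V} {σ : V → Bool} {u v : V} :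
    s(u, v) ∈ monoEdges G σ ↔ G.Adj u v ∧ σ u = σ v := by
  simp [monoEdges]

theorem componentSpinProb_eq {V : Type*} [Fintype V] {H : SimpleGraph V} (γ : V → ℝ)
    (C : H.ConnectedComponent) (b : Bool) [DecidablePred fun v => H.connectedComponentMk v = C] :
    componentSpinProb γ C b =
      Real.exp (∑ v with H.connectedComponentMk v = C, γ v * spin b) /
        (Real.exp (∑ v with H.connectedComponentMk v = C, γ v) +
          Real.exp (-∑ v with H.connectedComponentMk v = C, γ v)) := by
  rw [← Finset.sum_mul, componentSpinProb]
  have e : ∀ x : ℝ, Real.exp (2 * x) = Real.exp x * Real.exp x := fun x => by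
    rw [← Real.exp_add]; ring_nf
  simp only [e]
  have hc : (∑ v with H.connectedComponentMk v = C, γ v) =
    @Finset.sum _ _ _ (@Finset.filter _ (fun v => H.connectedComponentMk v = C)
      (fun _ => Classical.propDecidable _) Finset.univ) γ := by congr
  rw [← hc, Real.exp_neg]
  set x := ∑ v with H.connectedComponentMk v = C, γ v
  have hx := Real.exp_pos x
  cases b
  · simp only [spin, Bool.false_eq_true, if_false, mul_neg, mul_one, Real.exp_neg]
    field_simp
    ring
  · simp only [spin, if_true, mul_one]
    field_simp
    ring

open Classical in
/-- The normalising constant of the spins chosen by the components of `H`. -/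
noncomputable def componentNorm {V : Type*} [Fintype V] (H : SimpleGraph V) (γ : V → ℝ) : ℝ :=
  ∏ C : H.ConnectedComponent, (Real.exp (∑ v with H.connectedComponentMk v = C, γ v) +
          Real.exp (-∑ v with H.connectedComponentMk v = C, γ v))

open Classical in
theorem colorWeight_eq {V : Type*} [Fintype V] {H : SimpleGraph V} (γ : V → ℝ)
    (s : H.ConnectedComponent → Bool) :
    colorWeight γ s =
      Real.exp (∑ v, γ v * spin (s (H.connectedComponentMk v))) / componentNorm H γ := by
  simp only [colorWeight, componentSpinProb_eq]
  rw [Finset.prod_div_distrib, ← Real.exp_sum, componentNorm]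
  congr 2
  rw [← Finset.sum_fiberwise Finset.univ (fun v => H.connectedComponentMk v)]
  refine Finset.sum_congr rfl fun C _ => Finset.sum_congr rfl fun v hv => ?_
  rw [(Finset.mem_filter.1 hv).2]

theorem eq_of_reachable_fromEdgeSet {V : Type*} [Fintype V] {G : SimpleGraph V} {σ : V → Bool}
    {M : Finset (Sym2 V)} (hM : M ⊆ monoEdges G σ) {u v : V}
    (h : (SimpleGraph.fromEdgeSet (M : Set (Sym2 V))).Reachable u v) : σ u = σ v := by
  obtain ⟨w⟩ := h
  induction w with
  | nil => rfl
  | cons hadj _ ih =>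
    rw [SimpleGraph.fromEdgeSet_adj] at hadj
    exact (mem_monoEdges.1 (hM hadj.1)).2.trans ih

open Classical in
-- A colouring arises from the components of M exactly when M is monochromatic in it, and then from
-- a unique choice of component spins. The norm depends on M alone, which reversibility needs.
theorem coloringProb_eq {V : Type*} [Fintype V] (G : SimpleGraph V) (γ : V → ℝ)
    {M : Finset (Sym2 V)} (hM : M ⊆ G.edgeFinset) (τ : V → Bool) :
    coloringProb (SimpleGraph.fromEdgeSet (M : Set (Sym2 V))) γ τ =
      if M ⊆ monoEdges G τ then Real.exp (∑ v, γ v * spin (τ v)) /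
        componentNorm (SimpleGraph.fromEdgeSet (M : Set (Sym2 V))) γ else 0 := by
  set H := SimpleGraph.fromEdgeSet (M : Set (Sym2 V)) with hH
  split_ifs with h
  · obtain ⟨s, hs⟩ : ∃ s : H.ConnectedComponent → Bool,
        (fun v => s (H.connectedComponentMk v)) = τ :=
      ⟨fun C => C.lift τ fun _ _ p _ => eq_of_reachable_fromEdgeSet h p.reachable, by
        funext v; rfl⟩
    rw [coloringProb, Finset.sum_eq_single s, if_pos hs]
    · rw [← hs]
      exact colorWeight_eq γ s
    · intro s' _ hne
      rw [if_neg]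
      intro hs'
      apply hne
      funext C
      induction C using SimpleGraph.ConnectedComponent.ind with
      | h v => exact congrFun (hs'.trans hs.symm) v
    · simp
  · refine Finset.sum_eq_zero fun s _ => if_neg fun hs => h fun e he => ?_
    induction e with
    | h u v =>
      have hadj : G.Adj u v := by simpa using hM he
      refine mem_monoEdges.2 ⟨hadj, ?_⟩
      have : H.Adj u v := by
        rw [hH, SimpleGraph.fromEdgeSet_adj]
        exact ⟨he, hadj.ne⟩
      rw [← hs]
      simp only [SimpleGraph.ConnectedComponent.sound this.reachable]

open Classical in
-- The Edwards-Sokal joint weight: a bichromatic edge costs a factor exp (-2β) in the Ising weight,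
-- the same factor as a monochromatic edge that is dropped. Hence σ survives only in the field term.
theorem isingWeight_mul_percolationProb {V : Type*} [Fintype V] (G : SimpleGraph V)
    (β : Sym2 V → ℝ) (γ : V → ℝ) (σ : V → Bool) {M : Finset (Sym2 V)}
    (hM : M ⊆ monoEdges G σ) :
    isingWeight G β γ σ * percolationProb β (monoEdges G σ) M =
      Real.exp (∑ e ∈ G.edgeFinset, β e) * percolationProb β G.edgeFinset M *
        Real.exp (∑ v, γ v * spin (σ v)) := by
  have hE : monoEdges G σ ⊆ G.edgeFinset := Finset.filter_subset _ _
  have h1 : Real.exp (∑ e ∈ G.edgeFinset, β e * (e.map (fun v => spin (σ v))).mul) =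
      Real.exp (∑ e ∈ G.edgeFinset, β e) *
        ∏ e ∈ G.edgeFinset \ monoEdges G σ, Real.exp (-2 * β e) := by
    rw [Real.exp_sum, Real.exp_sum, ← Finset.prod_sdiff hE,
      ← Finset.prod_sdiff (f := fun e => Real.exp (β e)) hE, mul_right_comm,
      ← Finset.prod_mul_distrib]
    congr 1
    · refine Finset.prod_congr rfl fun e he => ?_
      rw [← Real.exp_add]
      congr 1
      induction e with
      | h u v =>
        have : σ u ≠ σ v := fun h => (Finset.mem_sdiff.1 he).2
          (mem_monoEdges.2 ⟨by simpa using (Finset.mem_sdiff.1 he).1, h⟩)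
        have h2 : spin (σ u) * spin (σ v) = -1 := by
          revert this
          cases σ u <;> cases σ v <;> simp [spin]
        simp only [Sym2.map_mk, Sym2.mul_mk, h2]
        ring
    · refine Finset.prod_congr rfl fun e he => ?_
      induction e with
      | h u v =>
        have h2 : spin (σ u) * spin (σ v) = 1 := by
          rw [(mem_monoEdges.1 he).2]
          cases σ v <;> simp [spin]
        simp only [Sym2.map_mk, Sym2.mul_mk, h2, mul_one]
  have h2 : (∏ e ∈ G.edgeFinset \ M, Real.exp (-2 * β e)) =
      (∏ e ∈ G.edgeFinset \ monoEdges G σ, Real.exp (-2 * β e)) *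
        ∏ e ∈ monoEdges G σ \ M, Real.exp (-2 * β e) := by
    rw [← Finset.prod_union]
    · congr 1
      ext e
      simp only [Finset.mem_union, Finset.mem_sdiff]
      constructor
      · tauto
      · rintro (⟨a, b⟩ | ⟨a, b⟩)
        · exact ⟨a, fun h => b (hM h)⟩
        · exact ⟨hE a, b⟩
    · rw [Finset.disjoint_left]
      intro e he he'
      exact (Finset.mem_sdiff.1 he).2 (Finset.mem_sdiff.1 he').1
  rw [isingWeight, Real.exp_add, h1, percolationProb, percolationProb, h2]
  ring

open Classical in
-- Detailed balance holds separately for each kept edge set M, because its contribution is symmetric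
-- in σ and τ.
theorem isingWeight_mul_transition {V : Type*} [Fintype V] (G : SimpleGraph V)
    (β : Sym2 V → ℝ) (γ : V → ℝ) (σ τ : V → Bool) :
    isingWeight G β γ σ * transition G β γ σ τ = isingWeight G β γ τ * transition G β γ τ σ := by
  have key : ∀ σ τ, isingWeight G β γ σ * transition G β γ σ τ =
      ∑ M ∈ G.edgeFinset.powerset, if M ⊆ monoEdges G σ ∧ M ⊆ monoEdges G τ then
        Real.exp (∑ e ∈ G.edgeFinset, β e) * percolationProb β G.edgeFinset M *
        Real.exp (∑ v, γ v * spin (σ v)) * (Real.exp (∑ v, γ v * spin (τ v)) /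
        componentNorm (SimpleGraph.fromEdgeSet (M : Set (Sym2 V))) γ) else 0 := by
    intro σ τ
    have hE : monoEdges G σ ⊆ G.edgeFinset := Finset.filter_subset _ _
    rw [transition, Matrix.of_apply, Finset.mul_sum,
      ← Finset.sum_subset (Finset.powerset_mono.2 hE)]
    · refine Finset.sum_congr rfl fun M hM => ?_
      rw [Finset.mem_powerset] at hM
      rw [← mul_assoc, isingWeight_mul_percolationProb G β γ σ hM,
        coloringProb_eq G γ (hM.trans hE)]
      simp [hM]
    · intro M _ hM
      rw [Finset.mem_powerset] at hM
      simp [hM]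
  rw [key, key]
  refine Finset.sum_congr rfl fun M _ => ?_
  simp only [and_comm (a := M ⊆ monoEdges G σ)]
  congr 1
  ring

open Classical in
theorem isingWeight_sum_pos {V : Type*} [Fintype V] (G : SimpleGraph V)
    (β : Sym2 V → ℝ) (γ : V → ℝ) : 0 < ∑ τ : V → Bool, isingWeight G β γ τ :=
  Finset.sum_pos (fun _ _ => Real.exp_pos _) Finset.univ_nonempty

open Classical in
theorem isingMeasure_vecMul_transition {V : Type*} [Fintype V] (G : SimpleGraph V)
    (β : Sym2 V → ℝ) (γ : V → ℝ) :
    isingMeasure G β γ ᵥ* transition G β γ = isingMeasure G β γ := by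
  funext τ
  simp only [vecMul, dotProduct, isingMeasure]
  simp only [div_mul_eq_mul_div, isingWeight_mul_transition G β γ _ τ]
  rw [← Finset.sum_div, ← Finset.mul_sum, sum_transition, mul_one]

open Classical in
theorem sum_pow_transition {V : Type*} [Fintype V] (G : SimpleGraph V) (β : Sym2 V → ℝ)
    (γ : V → ℝ) (t : ℕ) (σ : V → Bool) : ∑ τ, (transition G β γ ^ t) σ τ = 1 := by
  induction t generalizing σ with
  | zero => simp [Matrix.one_apply]
  | succ t ih =>
    simp only [pow_succ', Matrix.mul_apply]
    rw [Finset.sum_comm]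
    simp only [← Finset.mul_sum, ih, mul_one, sum_transition]

open Classical in
theorem pow_transition_nonneg {V : Type*} [Fintype V] {G : SimpleGraph V} {β : Sym2 V → ℝ}
    (hβ : Ferromagnetic G β) (γ : V → ℝ) (t : ℕ) (σ τ : V → Bool) :
    0 ≤ (transition G β γ ^ t) σ τ := by
  induction t generalizing σ with
  | zero => rw [pow_zero, Matrix.one_apply]; split_ifs <;> simp
  | succ t ih =>
    rw [pow_succ', Matrix.mul_apply]
    exact Finset.sum_nonneg fun ρ _ => mul_nonneg (transition_nonneg hβ γ σ ρ) (ih ρ)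

open Classical in
/-- A uniform lower bound on the probability of one configuration after `t` steps bounds the
mixing time. -/
theorem exists_isMixingTime_le {V : Type*} [Fintype V] {G : SimpleGraph V} {β : Sym2 V → ℝ}
    (hβ : Ferromagnetic G β) (γ : V → ℝ) {t k : ℕ} {q : ℝ} {ρ : V → Bool}
    (hq : ∀ σ, q ≤ (transition G β γ ^ t) σ ρ) (hk : (1 - q) ^ k ≤ 1 / 4) :
    ∃ T, IsMixingTime G β γ T ∧ T ≤ t * k := by
  have hmem : t * k ∈ {t : ℕ | ∀ (σ : V → Bool) (A : Finset (V → Bool)),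
      |probAt G β γ t σ A - ∑ τ ∈ A, isingMeasure G β γ τ| ≤ 1 / 4} := by
    intro σ A
    have h := abs_mulVec_sub_le (pow_transition_nonneg hβ γ t) (sum_pow_transition G β γ t) hq
      (μ := isingMeasure G β γ)
      (fun τ => div_nonneg (Real.exp_pos _).le (isingWeight_sum_pos G β γ).le)
      (by
        simp only [isingMeasure]
        rw [← Finset.sum_div, div_self (isingWeight_sum_pos G β γ).ne'])
      (by
        clear hq hk
        induction t with
        | zero => simp
        | succ t ih => rw [pow_succ, ← vecMul_vecMul, ih, isingMeasure_vecMul_transition])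
      (f := fun τ => if τ ∈ A then 1 else 0) (fun τ => by split_ifs <;> simp) k σ
    rw [← pow_mul] at h
    simpa [mulVec, dotProduct, probAt] using h.trans hk
  exact ⟨sInf _, ⟨Nat.sInf_mem ⟨_, hmem⟩, fun _ h => Nat.sInf_le h⟩, Nat.sInf_le hmem⟩

/-! ### Percolation connects robust sets -/

theorem colorExp_sub_mul {V : Type*} [Fintype V] (H : SimpleGraph V) (γ : V → ℝ) (c a : ℝ)
    (g : (V → Bool) → ℝ) :
    colorExp H γ (fun τ => c - a * g τ) = c - a * colorExp H γ g := by
  have h := colorExp_const H γ c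
  simp only [colorExp] at h ⊢
  simp only [mul_sub, Finset.sum_sub_distrib, h, Finset.mul_sum]
  congr 1
  exact Finset.sum_congr rfl fun _ _ => by ring

/-- The probability that the edges kept from `M` have the property `Q`. -/
noncomputable def percProbOf {V : Type*} (β : Sym2 V → ℝ) (M : Finset (Sym2 V))
    (Q : Finset (Sym2 V) → Prop) : ℝ :=
  ∑ M' ∈ M.powerset, percolationProb β M M' * ind (Q M')

open Classical in
theorem percProbOf_le_sum {V κ : Type*} {β : Sym2 V → ℝ} {M : Finset (Sym2 V)}
    (hβ : ∀ e ∈ M, 0 ≤ β e) {Q : Finset (Sym2 V) → Prop} (A : Finset κ)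
    {R : κ → Finset (Sym2 V) → Prop} (h : ∀ M' ⊆ M, Q M' → ∃ k ∈ A, R k M') :
    percProbOf β M Q ≤ ∑ k ∈ A, percProbOf β M (R k) := by
  simp only [percProbOf]
  rw [Finset.sum_comm]
  refine Finset.sum_le_sum fun M' hM' => ?_
  rw [Finset.mem_powerset] at hM'
  rw [← Finset.mul_sum]
  refine mul_le_mul_of_nonneg_left ?_ (percolationProb_nonneg hβ hM')
  by_cases hQ : Q M'
  · obtain ⟨k, hk, hR⟩ := h M' hM' hQ
    rw [ind_of hQ, ← ind_of hR]
    exact Finset.single_le_sum (f := fun k => ind (R k M')) (fun _ _ => ind_nonneg _) hk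
  · rw [ind_of_not hQ]
    exact Finset.sum_nonneg fun _ _ => ind_nonneg _

open Classical in
/-- The pairs in `T × U` that are adjacent in `G`. -/
noncomputable def edgesBetween {V : Type*} (G : SimpleGraph V) (T U : Finset V) :
    Finset (V × V) :=
  (T ×ˢ U).filter fun x => G.Adj x.1 x.2

open Classical in
/-- Every cut of the graph induced on `X` has at least `κ` edges per vertex of its smaller side. -/
def Robust {V : Type*} (G : SimpleGraph V) (κ : ℝ) (X : Finset V) : Prop :=
  ∀ T ⊆ X, κ * min (T.card : ℝ) ((X \ T).card : ℝ) ≤ (edgesBetween G T (X \ T)).card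

theorem sym2Mk_injOn {V : Type*} {T U : Finset V} (h : Disjoint T U) :
    Set.InjOn (fun x : V × V => s(x.1, x.2)) (T ×ˢ U : Finset (V × V)) := by
  rintro ⟨a, b⟩ hab ⟨c, d⟩ hcd he
  simp only [Finset.coe_product, Set.mem_prod, Finset.mem_coe] at hab hcd
  simp only [Sym2.eq_iff] at he
  rcases he with ⟨rfl, rfl⟩ | ⟨rfl, rfl⟩
  · rfl
  · exact absurd hab.1 (Finset.disjoint_right.1 h hcd.2)

/-- All edges of `Gs` are edges of `G` with coupling at least `b`. -/
def StrongIn {V : Type*} (G : SimpleGraph V) (β : Sym2 V → ℝ) (b : ℝ) (Gs : SimpleGraph V) :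
    Prop :=
  ∀ e ∈ Gs.edgeSet, e ∈ G.edgeSet ∧ b ≤ β e

open Classical in
/-- The vertices of `X` are connected to each other by the edges in `M`. -/
def Joins {V : Type*} (M : Finset (Sym2 V)) (X : Finset V) : Prop :=
  ∀ u ∈ X, ∀ v ∈ X, (SimpleGraph.fromEdgeSet (M : Set (Sym2 V))).Reachable u v

open Classical in
-- If X is not joined, some proper nonempty T ⊆ X loses all its edges to X \ T. Robustness makes
-- this as unlikely as y to the size of the smaller side, and the sum over T is evaluated by the
-- binomial theorem.
theorem percProbOf_not_joins_le {V : Type*} [Fintype V] {G Gs : SimpleGraph V} {β : Sym2 V → ℝ}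
    (hβ : Ferromagnetic G β) {b κ : ℝ} (hb : 0 ≤ b) (hs : StrongIn G β b Gs) {X : Finset V}
    (hX : Robust Gs κ X) {σ : V → Bool} (hσ : ∀ u ∈ X, ∀ v ∈ X, σ u = σ v) :
    percProbOf β (monoEdges G σ) (fun M' => ¬ Joins M' X) ≤
      2 * ((1 + Real.exp (-2 * b * κ)) ^ X.card - 1) := by
  set y := Real.exp (-2 * b * κ) with hy
  have hy0 : 0 < y := Real.exp_pos _
  let F : Finset V → Finset (Sym2 V) := fun T =>
    (edgesBetween Gs T (X \ T)).image fun x : V × V => s(x.1, x.2)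
  have h1 : percProbOf β (monoEdges G σ) (fun M' => ¬ Joins M' X) ≤
      ∑ T ∈ X.powerset with T ≠ ∅ ∧ X \ T ≠ ∅,
        percProbOf β (monoEdges G σ) (fun M' => Disjoint M' (F T)) := by
    refine percProbOf_le_sum (hβ.monoEdges σ) _ fun M' hM' hj => ?_
    simp only [Joins, not_forall] at hj
    obtain ⟨u, hu, v, hv, huv⟩ := hj
    -- The cut is the trace on X of the cluster of u.
    refine ⟨X.filter fun w => (SimpleGraph.fromEdgeSet (M' : Set (Sym2 V))).Reachable u w,
      ?_, ?_⟩
    · rw [Finset.mem_filter, Finset.mem_powerset]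
      refine ⟨Finset.filter_subset _ _, ?_, ?_⟩
      · exact Finset.ne_empty_of_mem (Finset.mem_filter.2 ⟨hu, SimpleGraph.Reachable.refl u⟩)
      · exact Finset.ne_empty_of_mem (a := v) (by simp [hv, huv])
    · rw [Finset.disjoint_right]
      rintro e he heM
      obtain ⟨⟨a, c⟩, hac, rfl⟩ := Finset.mem_image.1 he
      simp only [edgesBetween, Finset.mem_filter, Finset.mem_product, Finset.mem_sdiff] at hac
      obtain ⟨⟨⟨_, hua⟩, hcX, hc⟩, hadj⟩ := hac
      refine hc ⟨hcX, hua.trans (SimpleGraph.Adj.reachable ?_)⟩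
      rw [SimpleGraph.fromEdgeSet_adj]
      exact ⟨heM, hadj.ne⟩
  have h2 : ∀ T ∈ X.powerset, percProbOf β (monoEdges G σ) (fun M' => Disjoint M' (F T)) ≤
      y ^ T.card + y ^ (X \ T).card := by
    intro T hT
    rw [Finset.mem_powerset] at hT
    have hFG : ∀ e ∈ F T, e ∈ Gs.edgeSet ∧ e ∈ monoEdges G σ := by
      intro e he
      obtain ⟨⟨a, c⟩, hac, rfl⟩ := Finset.mem_image.1 he
      simp only [edgesBetween, Finset.mem_filter, Finset.mem_product, Finset.mem_sdiff] at hac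
      exact ⟨hac.2, mem_monoEdges.2 ⟨(hs s(a, c) hac.2).1, hσ _ (hT hac.1.1) _ hac.1.2.1⟩⟩
    have hcard : (F T).card = (edgesBetween Gs T (X \ T)).card := by
      refine Finset.card_image_of_injOn ?_
      refine (sym2Mk_injOn (T := T) (U := X \ T) Finset.disjoint_sdiff).mono ?_
      exact_mod_cast Finset.filter_subset _ _
    rw [percProbOf, sum_percolationProb_disjoint β (fun e he => (hFG e he).2)]
    calc ∏ e ∈ F T, Real.exp (-2 * β e) ≤ ∏ e ∈ F T, Real.exp (-2 * b) := by
          refine Finset.prod_le_prod (fun _ _ => (Real.exp_pos _).le) fun e he => ?_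
          rw [Real.exp_le_exp]
          linarith [(hs e (hFG e he).1).2]
      _ = Real.exp (-2 * b * (edgesBetween Gs T (X \ T)).card) := by
          rw [Finset.prod_const, hcard, ← Real.exp_nat_mul]
          congr 1
          ring
      _ ≤ Real.exp (-2 * b * (κ * min (T.card : ℝ) ((X \ T).card : ℝ))) := by
          rw [Real.exp_le_exp]
          nlinarith [hX T hT]
      -- Counting both sides, whichever is smaller, makes each sum over T binomial; the excluded
      -- trivial cuts account for the subtracted 1.
      _ ≤ y ^ T.card + y ^ (X \ T).card := by
          rw [hy, ← Real.exp_nat_mul, ← Real.exp_nat_mul]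
          rcases min_choice (T.card : ℝ) ((X \ T).card : ℝ) with h | h <;> rw [h]
          · have : -2 * b * (κ * T.card) = T.card * (-2 * b * κ) := by ring
            rw [this]
            linarith [Real.exp_pos ((X \ T).card * (-2 * b * κ))]
          · have : -2 * b * (κ * (X \ T).card) = (X \ T).card * (-2 * b * κ) := by ring
            rw [this]
            linarith [Real.exp_pos (T.card * (-2 * b * κ))]
  have h3 : ∑ T ∈ X.powerset, y ^ T.card = (1 + y) ^ X.card := by
    have := Finset.sum_pow_mul_eq_add_pow y 1 X
    simpa [add_comm] using this
  have h4 : ∑ T ∈ X.powerset, y ^ (X \ T).card = (1 + y) ^ X.card := by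
    have := Finset.sum_pow_mul_eq_add_pow 1 y X
    rw [← this]
    refine Finset.sum_congr rfl fun T hT => ?_
    rw [Finset.card_sdiff_of_subset (Finset.mem_powerset.1 hT)]
    simp
  refine h1.trans ((Finset.sum_le_sum fun T hT => h2 T (Finset.mem_filter.1 hT).1).trans ?_)
  rw [Finset.sum_add_distrib]
  have h5 : ∑ T ∈ X.powerset with T ≠ ∅ ∧ X \ T ≠ ∅, y ^ T.card ≤ (1 + y) ^ X.card - 1 := by
    rw [← h3, ← Finset.add_sum_erase _ _ (Finset.empty_mem_powerset X)]
    simp only [Finset.card_empty, pow_zero, add_sub_cancel_left]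
    refine Finset.sum_le_sum_of_subset_of_nonneg (fun T hT => ?_) fun _ _ _ => by positivity
    rw [Finset.mem_filter] at hT
    exact Finset.mem_erase.2 ⟨hT.2.1, hT.1⟩
  have h6 : ∑ T ∈ X.powerset with T ≠ ∅ ∧ X \ T ≠ ∅, y ^ (X \ T).card ≤
      (1 + y) ^ X.card - 1 := by
    rw [← h4, ← Finset.add_sum_erase _ _ (Finset.mem_powerset_self X)]
    simp only [Finset.sdiff_self, Finset.card_empty, pow_zero, add_sub_cancel_left]
    refine Finset.sum_le_sum_of_subset_of_nonneg (fun T hT => ?_) fun _ _ _ => by positivity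
    rw [Finset.mem_filter] at hT
    exact Finset.mem_erase.2 ⟨fun h => hT.2.2 (by rw [h, Finset.sdiff_self]), hT.1⟩
  linarith

open Classical in
theorem percProbOf_exists_not_joins_le {V ι : Type*} [Fintype V] [Fintype ι]
    {G Gs : SimpleGraph V} {β : Sym2 V → ℝ} (hβ : Ferromagnetic G β) {b κ : ℝ} (hb : 0 ≤ b)
    (hs : StrongIn G β b Gs) {X : ι → Finset V} (hX : ∀ i, Robust Gs κ (X i)) {σ : V → Bool}
    (hσ : ∀ i, ∀ u ∈ X i, ∀ v ∈ X i, σ u = σ v) :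
    percProbOf β (monoEdges G σ) (fun M' => ¬ ∀ i, Joins M' (X i)) ≤
      Fintype.card ι * (2 * ((1 + Real.exp (-2 * b * κ)) ^ Fintype.card V - 1)) := by
  refine (percProbOf_le_sum (hβ.monoEdges σ) Finset.univ (R := fun i M' => ¬ Joins M' (X i))
    fun M' _ h => by
      obtain ⟨i, hi⟩ := not_forall.1 h
      exact ⟨i, Finset.mem_univ i, hi⟩).trans ?_
  calc _ ≤ ∑ _i : ι, 2 * ((1 + Real.exp (-2 * b * κ)) ^ Fintype.card V - 1) := by
        refine Finset.sum_le_sum fun i _ =>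
          (percProbOf_not_joins_le hβ hb hs (hX i) (hσ i)).trans ?_
        have : (1 + Real.exp (-2 * b * κ)) ^ (X i).card ≤
            (1 + Real.exp (-2 * b * κ)) ^ Fintype.card V :=
          pow_le_pow_right₀ (by linarith [Real.exp_pos (-2 * b * κ)]) (Finset.card_le_univ _)
        linarith
    _ = _ := by simp

/-! ### Lower bounds for the transitions of the chain -/

open Classical in
theorem le_sum_transition_mul {V : Type*} [Fintype V] {G : SimpleGraph V} {β : Sym2 V → ℝ}
    (hβ : Ferromagnetic G β) {γ : V → ℝ} {σ : V → Bool} {f : (V → Bool) → ℝ} (hf : ∀ τ, 0 ≤ f τ)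
    {Q : Finset (Sym2 V) → Prop} {a η : ℝ} (ha : a ≤ 1)
    (hQ : percProbOf β (monoEdges G σ) (fun M' => ¬ Q M') ≤ η)
    (h : ∀ M' ⊆ monoEdges G σ, Q M' →
      a ≤ colorExp (SimpleGraph.fromEdgeSet (M' : Set (Sym2 V))) γ f) :
    a - η ≤ ∑ τ, transition G β γ σ τ * f τ := by
  rw [sum_transition_mul]
  calc a - η ≤ a - percProbOf β (monoEdges G σ) (fun M' => ¬ Q M') := by linarith
    _ = ∑ M' ∈ (monoEdges G σ).powerset, percolationProb β (monoEdges G σ) M' *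
        (a - ind (¬ Q M')) := by
      simp only [mul_sub, Finset.sum_sub_distrib, ← Finset.sum_mul, sum_percolationProb, one_mul,
        percProbOf]
    _ ≤ _ := by
      refine Finset.sum_le_sum fun M' hM' => ?_
      rw [Finset.mem_powerset] at hM'
      refine mul_le_mul_of_nonneg_left ?_ (percolationProb_nonneg (hβ.monoEdges σ) hM')
      by_cases hq : Q M'
      · rw [ind_of_not (not_not.2 hq), sub_zero]
        exact h M' hM' hq
      · rw [ind_of hq]
        refine le_trans (sub_nonpos.2 ha) ?_
        exact Finset.sum_nonneg fun s _ => mul_nonneg (colorWeight_nonneg γ s) (hf _)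

open Classical in
/-- If every set between `S` and `W` is robust inside each block, then a configuration that is
constant on `S` in each block becomes constant on `W` in each block: the expected number of
vertices of `W` that disagree with `S` is halved in every step. -/
theorem le_pow_transition_constant {V ι : Type*} [Fintype V] [Fintype ι]
    {G Gs : SimpleGraph V} {β : Sym2 V → ℝ} (hβ : Ferromagnetic G β) {γ : V → ℝ} {z : Bool}
    (hz : Favours γ z) {b κ : ℝ} (hb : 0 ≤ b) (hs : StrongIn G β b Gs)
    {blk : V → ι} {c : ι → V} {S W : Finset V} (hc : ∀ i, c i ∈ S ∧ blk (c i) = i)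
    (hSW : S ⊆ W)
    (hrob : ∀ X, S ⊆ X → X ⊆ W → ∀ i, Robust Gs κ (X.filter fun v => blk v = i))
    {η : ℝ}
    (hη : Fintype.card ι * (2 * ((1 + Real.exp (-2 * b * κ)) ^ Fintype.card V - 1)) ≤ η)
    (hη0 : 0 ≤ η) (t : ℕ) (σ : V → Bool) (hσ : ∀ v ∈ S, σ v = σ (c (blk v))) :
    1 - (1 / 2) ^ t * (W.filter fun v => σ v ≠ σ (c (blk v))).card - t * η ≤
      ∑ τ, (transition G β γ ^ t) σ τ * ind (∀ v ∈ W, τ v = τ (c (blk v))) := by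
  induction t generalizing σ with
  | zero =>
    simp only [pow_zero, Matrix.one_apply, ite_mul, one_mul, zero_mul, Finset.sum_ite_eq,
      Finset.mem_univ, if_true, Nat.cast_zero, sub_zero]
    -- The base case is Markov's inequality: a configuration with a disagreement has at least one,
    -- so the left side is not positive.
    by_cases h : ∀ v ∈ W, σ v = σ (c (blk v))
    · rw [ind_of h]
      simp
    · rw [ind_of_not h]
      push Not at h
      obtain ⟨v, hv, hne⟩ := h
      have : 0 < (W.filter fun v => σ v ≠ σ (c (blk v))).card :=
        Finset.card_pos.2 ⟨v, Finset.mem_filter.2 ⟨hv, hne⟩⟩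
      have : (1 : ℝ) ≤ (W.filter fun v => σ v ≠ σ (c (blk v))).card := by exact_mod_cast this
      linarith
  | succ t ih =>
    set f : (V → Bool) → ℝ := fun ρ => ∑ τ, (transition G β γ ^ t) ρ τ *
      ind (∀ v ∈ W, τ v = τ (c (blk v))) with hf
    have e : ∑ τ, (transition G β γ ^ (t + 1)) σ τ *
        ind (∀ v ∈ W, τ v = τ (c (blk v))) =
        ∑ ρ, transition G β γ σ ρ * f ρ := by
      simp only [pow_succ', Matrix.mul_apply, Finset.sum_mul, hf, Finset.mul_sum, mul_assoc]
      exact Finset.sum_comm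
    rw [e]
    have h2t : (0 : ℝ) ≤ (1 / 2) ^ t := by positivity
    -- X consists of the vertices that already agree; it lies between S and W, so its blocks are
    -- robust and stay joined up to probability η.
    set X := W.filter fun v => σ v = σ (c (blk v)) with hX
    have hSX : S ⊆ X := fun v hv => Finset.mem_filter.2 ⟨hSW hv, hσ v hv⟩
    have hXW : X ⊆ W := Finset.filter_subset _ _
    have hP := percProbOf_exists_not_joins_le (G := G) (σ := σ) hβ hb hs (hrob X hSX hXW)
      (fun i u hu v hv => by
        rw [Finset.mem_filter] at hu hv
        rw [(Finset.mem_filter.1 hu.1).2, (Finset.mem_filter.1 hv.1).2, hu.2, hv.2])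
    have hmain := le_sum_transition_mul (γ := γ) (f := f)
      (a := 1 - t * η - (1 / 2) ^ t * ((W.filter fun v => σ v ≠ σ (c (blk v))).card / 2)) hβ
      (fun ρ => Finset.sum_nonneg fun τ _ => mul_nonneg (pow_transition_nonneg hβ γ t ρ τ)
        (ind_nonneg _)) (by
          have h1 : 0 ≤ t * η := mul_nonneg (Nat.cast_nonneg t) hη0
          have h2 : 0 ≤ (1 / 2 : ℝ) ^ t * ((W.filter fun v => σ v ≠ σ (c (blk v))).card / 2) :=
            mul_nonneg h2t (div_nonneg (Nat.cast_nonneg _) zero_le_two)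
          linarith only [h1, h2]) (hP.trans hη) ?_
    · refine le_trans (le_of_eq ?_) hmain
      push_cast
      ring
    · intro M' hM' hj
      set H := SimpleGraph.fromEdgeSet (M' : Set (Sym2 V))
      have hreach : ∀ v ∈ X, H.Reachable v (c (blk v)) := fun v hv =>
        hj (blk v) v (Finset.mem_filter.2 ⟨hv, rfl⟩) _
          (Finset.mem_filter.2 ⟨hSX (hc _).1, (hc _).2⟩)
      calc _ ≤ (1 - t * η) - (1 / 2) ^ t * colorExp H γ (fun τ =>
              ∑ v ∈ W with σ v ≠ σ (c (blk v)), ind (τ v ≠ τ (c (blk v)))) := by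
            rw [colorExp_sum]
            refine sub_le_sub_left (mul_le_mul_of_nonneg_left ?_ h2t) _
            refine (Finset.sum_le_sum fun v _ => colorExp_ne_le H hz v _).trans (le_of_eq ?_)
            rw [Finset.sum_const, nsmul_eq_mul]
            ring
        _ = _ := (colorExp_sub_mul H γ _ _ _).symm
        _ ≤ _ := by
            refine colorExp_mono fun τ hτ => ?_
            refine le_trans (le_of_eq ?_) (ih τ fun v hv => hτ _ _ (hreach v (hSX hv)))
            rw [← sum_ind, sub_right_comm]
            congr 2
            refine congrArg _ (Finset.sum_filter_of_ne (p := fun v => σ v ≠ σ (c (blk v)))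
              fun v hv h0 h => h0 (ind_of_not ?_))
            rw [not_not]
            exact hτ _ _ (hreach v (Finset.mem_filter.2 ⟨hv, h⟩))

open Classical in
theorem le_transition_const_of_constant {V ι : Type*} [Fintype V] [Fintype ι]
    {G Gs : SimpleGraph V} {β : Sym2 V → ℝ} (hβ : Ferromagnetic G β) {γ : V → ℝ} {z : Bool}
    (hz : Favours γ z) {b κ : ℝ} (hb : 0 ≤ b) (hs : StrongIn G β b Gs)
    {blk : V → ι} {c : ι → V} (hc : ∀ i, blk (c i) = i)
    (hrob : ∀ i, Robust Gs κ (Finset.univ.filter fun v => blk v = i))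
    {σ : V → Bool} (hσ : ∀ v, σ v = σ (c (blk v))) :
    (1 / 2) ^ Fintype.card ι -
      Fintype.card ι * (2 * ((1 + Real.exp (-2 * b * κ)) ^ Fintype.card V - 1)) ≤
      transition G β γ σ (fun _ => z) := by
  have hP := percProbOf_exists_not_joins_le (G := G) (σ := σ) hβ hb hs hrob
      (fun i u hu v hv => by
        rw [Finset.mem_filter] at hu hv
        rw [hσ u, hσ v, hu.2, hv.2])
  have hmain := le_sum_transition_mul (γ := γ) (f := fun τ => ind (τ = fun _ => z))
    (a := (1 / 2) ^ Fintype.card ι) hβ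
    (fun _ => ind_nonneg _) (pow_le_one₀ (by norm_num) (by norm_num)) hP ?_
  · simpa [ind] using hmain
  · intro M' hM' hj
    refine (le_colorExp_forall _ hz c).trans (colorExp_mono fun τ hτ => ?_)
    refine ind_mono fun h1 => funext fun v => ?_
    rw [← h1 (blk v)]
    exact hτ _ _ (hj (blk v) _ (by simp) _ (by simp [hc]))

open Classical in
-- A crude bound valid on every graph, used to settle the finitely many small n.
theorem le_transition_const {V : Type*} [Fintype V]
    {G : SimpleGraph V} {β : Sym2 V → ℝ} (hβ : Ferromagnetic G β) {γ : V → ℝ} {z : Bool}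
    (hz : Favours γ z) (σ : V → Bool) :
    (1 / 2) ^ Fintype.card V ≤ (transition G β γ ^ 1) σ (fun _ => z) := by
  rw [pow_one]
  have hmain := le_sum_transition_mul (γ := γ) (f := fun τ => ind (τ = fun _ => z))
    (a := (1 / 2) ^ Fintype.card V) (σ := σ) (Q := fun _ => True) (η := 0) hβ
    (fun _ => ind_nonneg _) (pow_le_one₀ (by norm_num) (by norm_num))
    (by simp [percProbOf, ind]) ?_
  · simpa [ind] using hmain
  · intro M' _ _
    refine (le_colorExp_forall _ hz id).trans (colorExp_mono fun τ _ => ?_)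
    exact ind_mono fun h => funext h

open Classical in
-- The product over the parts of the fractions of z is the probability that a random transversal is
-- all z, so its mean is at least 2^(-r). It is at most 1 and falls below 2^(-r-1) once a single
-- fraction does, so all fractions reach 2^(-r-1) with probability at least 2^(-r-1).
theorem le_transition_rich {V : Type*} [Fintype V] {r : ℕ}
    {G : SimpleGraph V} {β : Sym2 V → ℝ} (hβ : Ferromagnetic G β) {γ : V → ℝ} {z : Bool}
    (hz : Favours γ z) (part : V → Fin r) (hpart : ∀ j, ∃ v, part v = j) (σ : V → Bool) :
    (1 / 2) ^ (r + 1) ≤ ∑ τ, transition G β γ σ τ *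
      ind (∀ j, (1 / 2 : ℝ) ^ (r + 1) * (Finset.univ.filter fun v => part v = j).card ≤
        (Finset.univ.filter fun v => part v = j ∧ τ v = z).card) := by
  have hmain := le_sum_transition_mul (γ := γ) (f := fun τ =>
      ind (∀ j, (1 / 2 : ℝ) ^ (r + 1) * (Finset.univ.filter fun v => part v = j).card ≤
        (Finset.univ.filter fun v => part v = j ∧ τ v = z).card))
    (a := (1 / 2) ^ (r + 1)) (σ := σ) (Q := fun _ => True) (η := 0) hβ
    (fun _ => ind_nonneg _) (pow_le_one₀ (by norm_num) (by norm_num))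
    (by simp [percProbOf, ind]) ?_
  · simpa only [sub_zero] using hmain
  intro M' _ _
  set H := SimpleGraph.fromEdgeSet (M' : Set (Sym2 V))
  set P : Fin r → Finset V := fun j => Finset.univ.filter fun v => part v = j with hPdef
  have hP0 : ∀ j, (0 : ℝ) < (P j).card := fun j => by
    obtain ⟨v, hv⟩ := hpart j
    exact_mod_cast Finset.card_pos.2 ⟨v, by simp [hPdef, hv]⟩
  have hprod : ∀ τ : V → Bool,
      ∏ j, ((Finset.univ.filter fun v => part v = j ∧ τ v = z).card : ℝ) =
      ∑ c ∈ Fintype.piFinset P, ind (∀ j, τ (c j) = z) := by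
    intro τ
    have h := Finset.prod_univ_sum P (fun _ v => ind (τ v = z))
    simp only [prod_ind, Finset.mem_univ, true_imp_iff] at h
    rw [← h]
    refine Finset.prod_congr rfl fun j _ => ?_
    rw [sum_ind, hPdef, Finset.filter_filter]
  set m : ℝ := ∏ j, ((P j).card : ℝ) with hm
  have hm0 : 0 < m := Finset.prod_pos fun j _ => hP0 j
  have hE : m * (1 / 2) ^ r ≤ colorExp H γ (fun τ =>
      ∑ c ∈ Fintype.piFinset P, ind (∀ j, τ (c j) = z)) := by
    rw [colorExp_sum]
    calc m * (1 / 2) ^ r = ∑ c ∈ Fintype.piFinset P, (1 / 2 : ℝ) ^ r := by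
          rw [Finset.sum_const, nsmul_eq_mul, Fintype.card_piFinset, hm]
          push_cast
          rfl
      _ ≤ _ := Finset.sum_le_sum fun c _ => by
          have := le_colorExp_forall H hz c
          rwa [Fintype.card_fin] at this
  -- The double negative writes the product minus 2^(-r-1) in the shape that `colorExp_sub_mul`
  -- handles.
  have hpw : ∀ τ : V → Bool, -(1 / 2 : ℝ) ^ (r + 1) -
      (-m⁻¹) * (∑ c ∈ Fintype.piFinset P, ind (∀ j, τ (c j) = z)) ≤
      ind (∀ j, (1 / 2 : ℝ) ^ (r + 1) * (P j).card ≤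
        (Finset.univ.filter fun v => part v = j ∧ τ v = z).card) := by
    intro τ
    rw [← hprod]
    have hle : ∀ j, ((Finset.univ.filter fun v => part v = j ∧ τ v = z).card : ℝ) / (P j).card
        ≤ 1 := fun j => by
      rw [div_le_one (hP0 j)]
      exact_mod_cast Finset.card_le_card
        (fun v hv => by
          simp only [Finset.mem_filter, Finset.mem_univ, true_and, hPdef] at hv ⊢
          exact hv.1)
    have hq : -(1 / 2 : ℝ) ^ (r + 1) -
        (-m⁻¹) * ∏ j, ((Finset.univ.filter fun v => part v = j ∧ τ v = z).card : ℝ) =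
        -(1 / 2 : ℝ) ^ (r + 1) +
        ∏ j, (((Finset.univ.filter fun v => part v = j ∧ τ v = z).card : ℝ) / (P j).card) := by
      rw [Finset.prod_div_distrib]
      ring
    rw [hq]
    by_cases h : ∀ j, (1 / 2 : ℝ) ^ (r + 1) * (P j).card ≤
        (Finset.univ.filter fun v => part v = j ∧ τ v = z).card
    · rw [ind_of h]
      have := Finset.prod_le_one (s := Finset.univ) (fun j _ => by positivity)
        (fun j _ => hle j)
      have : (0 : ℝ) ≤ (1 / 2) ^ (r + 1) := by positivity
      linarith
    · rw [ind_of_not h]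
      push Not at h
      obtain ⟨j, hj⟩ := h
      rw [← div_lt_iff₀ (hP0 j)] at hj
      have : ∏ j, (((Finset.univ.filter fun v => part v = j ∧ τ v = z).card : ℝ) /
          (P j).card) ≤
          ((Finset.univ.filter fun v => part v = j ∧ τ v = z).card : ℝ) / (P j).card := by
        rw [← Finset.mul_prod_erase _ _ (Finset.mem_univ j)]
        exact mul_le_of_le_one_right (by positivity)
          (Finset.prod_le_one (fun j _ => by positivity) fun j _ => hle j)
      linarith only [this, hj]
  refine le_trans ?_ (colorExp_mono (H := H) (γ := γ) fun τ _ => hpw τ)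
  rw [colorExp_sub_mul]
  have : m⁻¹ * (m * (1 / 2) ^ r) ≤ m⁻¹ * colorExp H γ (fun τ =>
      ∑ c ∈ Fintype.piFinset P, ind (∀ j, τ (c j) = z)) :=
    mul_le_mul_of_nonneg_left hE (inv_nonneg.2 hm0.le)
  rw [← mul_assoc, inv_mul_cancel₀ hm0.ne', one_mul] at this
  have hr : (1 / 2 : ℝ) ^ (r + 1) = (1 / 2) ^ r * (1 / 2) := pow_succ _ _
  linarith only [this, hr]

/-! ### Relevant pairs, good graphs and robust blocks -/

open Classical in
/-- The pairs in `T × U` whose pair of parts satisfies `S`. -/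
noncomputable def relPairs {V : Type*} {r : ℕ} (part : V → Fin r) (S : Sym2 (Fin r) → Prop)
    (T U : Finset V) : Finset (V × V) :=
  (T ×ˢ U).filter fun x => S s(part x.1, part x.2)

/-- The subgraph of the edges whose pair of parts satisfies `S`. -/
def relGraph {V : Type*} {r : ℕ} (part : V → Fin r) (S : Sym2 (Fin r) → Prop)
    (G : SimpleGraph V) : SimpleGraph V where
  Adj u v := G.Adj u v ∧ S s(part u, part v)
  symm := ⟨fun u v h => ⟨h.1.symm, by rw [Sym2.eq_swap]; exact h.2⟩⟩
  loopless := ⟨fun v h => G.loopless.irrefl v h.1⟩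

open Classical in
theorem card_edgesBetween {V : Type*} (G : SimpleGraph V) (T U : Finset V) :
    (edgesBetween G T U).card = ∑ v ∈ T, (U.filter fun w => G.Adj v w).card := by
  simp only [edgesBetween, Finset.card_filter, Finset.sum_product]

open Classical in
theorem card_relPairs {V : Type*} {r : ℕ} (part : V → Fin r) (S : Sym2 (Fin r) → Prop)
    (T U : Finset V) :
    (relPairs part S T U).card =
      ∑ v ∈ T, (U.filter fun w => S s(part v, part w)).card := by
  simp only [relPairs, Finset.card_filter, Finset.sum_product]

open Classical in
theorem card_edgesBetween_comm {V : Type*} (G : SimpleGraph V) (T U : Finset V) :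
    (edgesBetween G T U).card = (edgesBetween G U T).card := by
  simp only [edgesBetween, Finset.card_filter]
  rw [Finset.sum_product_right, Finset.sum_product]
  simp only [G.adj_comm]

open Classical in
theorem mul_card_le_edgesBetween {V : Type*} {G : SimpleGraph V} {X T : Finset V} {d : ℝ}
    (hdeg : ∀ v ∈ X, d ≤ (X.filter fun w => G.Adj v w).card) (hT : T ⊆ X)
    (hTd : (T.card : ℝ) ≤ d / 2) :
    d / 2 * T.card ≤ (edgesBetween G T (X \ T)).card := by
  rw [card_edgesBetween]
  push_cast
  have : ∀ v ∈ T, d / 2 ≤ (((X \ T).filter fun w => G.Adj v w).card : ℝ) := by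
    intro v hv
    have h1 : (X.filter fun w => G.Adj v w).card ≤
        ((X \ T).filter fun w => G.Adj v w).card + T.card := by
      rw [← Finset.card_filter_add_card_filter_not (s := X.filter fun w => G.Adj v w)
        (fun w => w ∉ T)]
      refine Nat.add_le_add (Finset.card_le_card fun w hw => ?_)
        (Finset.card_le_card fun w hw => ?_)
      · simp only [Finset.mem_filter, Finset.mem_sdiff] at hw ⊢
        tauto
      · simp only [Finset.mem_filter] at hw
        tauto
    have h2 : ((X.filter fun w => G.Adj v w).card : ℝ) ≤
        ((X \ T).filter fun w => G.Adj v w).card + T.card := by exact_mod_cast h1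
    linarith [hdeg v (hT hv)]
  calc d / 2 * T.card = ∑ v ∈ T, d / 2 := by rw [Finset.sum_const, nsmul_eq_mul]; ring
    _ ≤ _ := Finset.sum_le_sum this

open Classical in
-- A side with at most d/2 vertices cannot contain half the neighbours of any of its vertices, so
-- minimum degree suffices there; only balanced cuts need a separate edge count.
theorem robust_of_degree_of_cut {V : Type*} {G : SimpleGraph V} {X : Finset V} {d m κ : ℝ}
    (hdeg : ∀ v ∈ X, d ≤ (X.filter fun w => G.Adj v w).card)
    (hcut : ∀ T ⊆ X, d / 2 ≤ T.card → d / 2 ≤ ((X \ T).card : ℝ) →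
      m * X.card ≤ (edgesBetween G T (X \ T)).card)
    (hκ0 : 0 ≤ κ) (hκd : κ ≤ d / 2) (hκm : κ ≤ m) : Robust G κ X := by
  intro T hT
  have hmin1 : min (T.card : ℝ) ((X \ T).card : ℝ) ≤ T.card := min_le_left _ _
  have hmin2 : min (T.card : ℝ) ((X \ T).card : ℝ) ≤ (X \ T).card := min_le_right _ _
  rcases le_total (T.card : ℝ) (d / 2) with h1 | h1
  · calc _ ≤ κ * T.card := mul_le_mul_of_nonneg_left hmin1 hκ0
      _ ≤ d / 2 * T.card := mul_le_mul_of_nonneg_right hκd (Nat.cast_nonneg _)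
      _ ≤ _ := mul_card_le_edgesBetween hdeg hT h1
  rcases le_total ((X \ T).card : ℝ) (d / 2) with h2 | h2
  · calc _ ≤ κ * (X \ T).card := mul_le_mul_of_nonneg_left hmin2 hκ0
      _ ≤ d / 2 * (X \ T).card := mul_le_mul_of_nonneg_right hκd (Nat.cast_nonneg _)
      _ ≤ _ := mul_card_le_edgesBetween hdeg Finset.sdiff_subset h2
      _ = _ := by
        rw [card_edgesBetween_comm, Finset.sdiff_sdiff_eq_self hT]
  · calc _ ≤ κ * X.card := by
          refine mul_le_mul_of_nonneg_left (hmin1.trans ?_) hκ0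
          exact_mod_cast Finset.card_le_card hT
      _ ≤ m * X.card := mul_le_mul_of_nonneg_right hκm (Nat.cast_nonneg _)
      _ ≤ _ := hcut T hT h1 h2

open Classical in
theorem mul_card_le_card_relPairs {V : Type*} {r : ℕ} (part : V → Fin r)
    {S : Sym2 (Fin r) → Prop} (T U : Finset V) {j k : Fin r} (h : S s(j, k)) :
    ((T.filter fun v => part v = j).card : ℝ) * (U.filter fun v => part v = k).card ≤
      (relPairs part S T U).card := by
  rw [← Nat.cast_mul, ← Finset.card_product]
  refine Nat.cast_le.2 (Finset.card_le_card fun x hx => ?_)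
  simp only [Finset.mem_product, Finset.mem_filter] at hx
  simp only [relPairs, Finset.mem_filter, Finset.mem_product]
  exact ⟨⟨hx.1.1, hx.2.1⟩, by rw [hx.1.2, hx.2.2]; exact h⟩

open Classical in
theorem exists_card_le_mul_card_part {V : Type*} {r : ℕ} (part : V → Fin r) {T : Finset V}
    (hT : T.Nonempty) : ∃ j, (∃ v ∈ T, part v = j) ∧
      (T.card : ℝ) ≤ r * (T.filter fun v => part v = j).card := by
  have hr : (Finset.univ : Finset (Fin r)).Nonempty := ⟨part hT.choose, Finset.mem_univ _⟩
  have h1 : T.card = ∑ j, (T.filter fun v => part v = j).card :=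
    Finset.card_eq_sum_card_fiberwise fun _ _ => Finset.mem_coe.2 (Finset.mem_univ _)
  obtain ⟨j, -, hj⟩ := Finset.exists_max_image Finset.univ
    (fun j => (T.filter fun v => part v = j).card) hr
  have h2 : T.card ≤ r * (T.filter fun v => part v = j).card := by
    rw [h1]
    calc _ ≤ ∑ _i : Fin r, (T.filter fun v => part v = j).card := Finset.sum_le_sum hj
      _ = _ := by simp
  refine ⟨j, ?_, by exact_mod_cast h2⟩
  have h3 : 0 < (T.filter fun v => part v = j).card := by
    have := hT.card_pos
    rcases Nat.eq_zero_or_pos (T.filter fun v => part v = j).card with h | h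
    · rw [h] at h2; omega
    · exact h
  obtain ⟨v, hv⟩ := Finset.card_pos.1 h3
  exact ⟨v, (Finset.mem_filter.1 hv).1, (Finset.mem_filter.1 hv).2⟩

/-- The blocks of parts given by `blk` fit the relevant pairs `S`: relevant pairs lie inside
blocks, all pairs of different parts in a block are relevant, and every part has a relevant
partner. -/
structure BlocksFit {ι : Type*} {r : ℕ} (S : Sym2 (Fin r) → Prop) (blk : Fin r → ι) : Prop where
  surjective : Function.Surjective blk
  eq_of_rel : ∀ j k, S s(j, k) → blk j = blk k
  rel_of_ne : ∀ j k, blk j = blk k → j ≠ k → S s(j, k)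
  exists_rel : ∀ j, ∃ k, S s(j, k)

open Classical in
-- By pigeonhole T is large in some part j and X \ T in some part l. If that pair is not relevant,
-- then j = l, and one side holds half of a relevant partner part of j; it is paired with part j on
-- the other side.
theorem BlocksFit.le_card_relPairs {V ι : Type*} {r : ℕ} {part : V → Fin r}
    {S : Sym2 (Fin r) → Prop} {blk : Fin r → ι} (h : BlocksFit S blk) {X : Finset V} {i : ι}
    (hX : ∀ v ∈ X, blk (part v) = i) {R a k : ℝ} (hR : (r : ℝ) ≤ R) (hR0 : 0 < R) (ha : 0 < a)
    (hak : a / R ≤ k / 2)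
    (hrich : ∀ j, blk j = i → k ≤ (X.filter fun v => part v = j).card) {T : Finset V}
    (hTX : T ⊆ X) (hT : a ≤ T.card) (hU : a ≤ ((X \ T).card : ℝ)) :
    (a / R) ^ 2 ≤ (relPairs part S T (X \ T)).card := by
  have haR : 0 ≤ a / R := (div_pos ha hR0).le
  have big : ∀ T : Finset V, T ⊆ X → a ≤ T.card → ∃ j, blk j = i ∧
      a / R ≤ (T.filter fun v => part v = j).card := by
    intro T hTX hT
    have hne : T.Nonempty := Finset.card_pos.1 (by exact_mod_cast ha.trans_le hT)
    obtain ⟨j, ⟨v, hv, rfl⟩, hj⟩ := exists_card_le_mul_card_part part hne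
    refine ⟨_, hX v (hTX hv), ?_⟩
    rw [div_le_iff₀ hR0, mul_comm]
    exact hT.trans (hj.trans (mul_le_mul_of_nonneg_right hR (Nat.cast_nonneg _)))
  have conc : ∀ j l, S s(j, l) → a / R ≤ (T.filter fun v => part v = j).card →
      a / R ≤ ((X \ T).filter fun v => part v = l).card →
      (a / R) ^ 2 ≤ (relPairs part S T (X \ T)).card := by
    intro j l hjl h1 h2
    refine le_trans ?_ (mul_card_le_card_relPairs part T (X \ T) hjl)
    rw [pow_two]
    exact mul_le_mul h1 h2 haR (haR.trans h1)
  obtain ⟨j, hji, hj⟩ := big T hTX hT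
  obtain ⟨l, hli, hl⟩ := big (X \ T) Finset.sdiff_subset hU
  by_cases hjl : S s(j, l)
  · exact conc j l hjl hj hl
  have hjl' : j = l := by
    by_contra hne
    exact hjl (h.rel_of_ne j l (hji.trans hli.symm) hne)
  subst hjl'
  obtain ⟨m, hm⟩ := h.exists_rel j
  have hsum : (X.filter fun v => part v = m).card ≤
      (T.filter fun v => part v = m).card + ((X \ T).filter fun v => part v = m).card := by
    rw [← Finset.card_union_of_disjoint
      (Finset.disjoint_filter_filter Finset.disjoint_sdiff), ← Finset.filter_union,
      Finset.union_sdiff_of_subset hTX]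
  have hsum' : ((X.filter fun v => part v = m).card : ℝ) ≤
      (T.filter fun v => part v = m).card + ((X \ T).filter fun v => part v = m).card := by
    exact_mod_cast hsum
  have hmi := hrich m ((h.eq_of_rel j m hm).symm.trans hji)
  rcases le_total (k / 2) ((T.filter fun v => part v = m).card : ℝ) with h1 | h1
  · exact conc m j (by rw [Sym2.eq_swap]; exact hm) (hak.trans h1) hl
  · exact conc j m hm hj (hak.trans (by linarith))

open Classical in
/-- The graph has many relevant edges between all disjoint sets with at least `m` relevant pairs,
and at every vertex. -/
structure GoodGraph {V : Type*} [Fintype V] {r : ℕ} (part : V → Fin r)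
    (S : Sym2 (Fin r) → Prop) (p m : ℝ) (G : SimpleGraph V) : Prop where
  dense : ∀ T U : Finset V, Disjoint T U → m ≤ (relPairs part S T U).card →
    p / 4 * (relPairs part S T U).card ≤ (edgesBetween (relGraph part S G) T U).card
  degree : ∀ v : V, p / 4 * (relPairs part S {v} {v}ᶜ).card ≤
    (edgesBetween (relGraph part S G) {v} {v}ᶜ).card

open Classical in
-- Many low-degree vertices would form a set with too few edges to B, against density.
theorem GoodGraph.card_low_degree_lt {V : Type*} [Fintype V] {r : ℕ} {part : V → Fin r}
    {S : Sym2 (Fin r) → Prop} {p m : ℝ} {G : SimpleGraph V} (hG : GoodGraph part S p m G)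
    {B : Finset V} {k l : ℝ}
    (hB : ∀ v, k ≤ (B.filter fun w => S s(part v, part w)).card)
    (hl : 1 ≤ l) (hlk : 2 * l ≤ k / 2) (hm : m ≤ l * (k / 2)) (hp : 0 ≤ p) :
    ((Finset.univ.filter fun v => ((B.filter fun w => (relGraph part S G).Adj v w).card : ℝ) <
      p * k / 8).card : ℝ) < l := by
  by_contra hcon
  push Not at hcon
  set L := Finset.univ.filter fun v =>
    ((B.filter fun w => (relGraph part S G).Adj v w).card : ℝ) < p * k / 8 with hL
  -- Density needs disjoint sets. Only ⌈l⌉ low-degree vertices are taken, so removing them from B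
  -- costs each vertex at most half of its k relevant partners.
  obtain ⟨M, hML, hM⟩ := Finset.exists_subset_card_eq (s := L) (n := ⌈l⌉₊) (Nat.ceil_le.2 hcon)
  have hM1 : l ≤ M.card := by rw [hM]; exact Nat.le_ceil l
  have hM2 : (M.card : ℝ) ≤ 2 * l := by
    rw [hM]
    have := Nat.ceil_lt_add_one (zero_le_one.trans hl)
    linarith
  have hrel : k / 2 * M.card ≤ (relPairs part S M (B \ M)).card := by
    rw [card_relPairs]
    push_cast
    calc k / 2 * M.card = ∑ v ∈ M, k / 2 := by rw [Finset.sum_const, nsmul_eq_mul]; ring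
      _ ≤ _ := by
        refine Finset.sum_le_sum fun v _ => ?_
        have h1 : (B.filter fun w => S s(part v, part w)).card ≤
            ((B \ M).filter fun w => S s(part v, part w)).card + M.card := by
          rw [← Finset.card_filter_add_card_filter_not
            (s := B.filter fun w => S s(part v, part w)) (fun w => w ∉ M)]
          refine Nat.add_le_add (Finset.card_le_card fun w hw => ?_)
            (Finset.card_le_card fun w hw => ?_)
          · simp only [Finset.mem_filter, Finset.mem_sdiff] at hw ⊢
            tauto
          · simp only [Finset.mem_filter] at hw
            tauto
        have h2 : ((B.filter fun w => S s(part v, part w)).card : ℝ) ≤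
            ((B \ M).filter fun w => S s(part v, part w)).card + M.card := by exact_mod_cast h1
        linarith [hB v]
  have hk : 0 < k := by linarith
  have hdense := hG.dense M (B \ M) Finset.disjoint_sdiff
    ((hm.trans (by nlinarith)).trans hrel)
  have hup : ((edgesBetween (relGraph part S G) M (B \ M)).card : ℝ) < p * k / 8 * M.card := by
    rw [card_edgesBetween]
    push_cast
    calc _ < ∑ v ∈ M, p * k / 8 := by
          refine Finset.sum_lt_sum_of_nonempty (Finset.card_pos.1 ?_) fun v hv => ?_
          · have : (0 : ℝ) < M.card := by linarith
            exact_mod_cast this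
          · refine lt_of_le_of_lt ?_ (Finset.mem_filter.1 (hML hv)).2
            exact_mod_cast Finset.card_le_card
              (Finset.filter_subset_filter _ Finset.sdiff_subset)
      _ = _ := by rw [Finset.sum_const, nsmul_eq_mul]; ring
  have : p / 4 * (k / 2 * M.card) ≤ p / 4 * (relPairs part S M (B \ M)).card :=
    mul_le_mul_of_nonneg_left hrel (by linarith)
  linarith

open Classical in
theorem card_filter_le_add_card_sdiff {V : Type*} {X Y Z : Finset V} (p : V → Prop)
    [DecidablePred p]
    (h : Y \ X ⊆ Z) :
    ((Y.filter p).card : ℝ) ≤ (X.filter p).card + Z.card := by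
  have : (Y.filter p).card ≤ (X.filter p).card + Z.card := by
    refine (Finset.card_le_card (t := X.filter p ∪ Z) fun v hv => ?_).trans
      (Finset.card_union_le _ _)
    rw [Finset.mem_filter] at hv
    rw [Finset.mem_union, Finset.mem_filter]
    by_cases hX : v ∈ X
    · exact Or.inl ⟨hX, hv.2⟩
    · exact Or.inr (h (Finset.mem_sdiff.2 ⟨hv.1, hX⟩))
  exact_mod_cast this

open Classical in
theorem GoodGraph.robust {V ι : Type*} [Fintype V] {r : ℕ} {part : V → Fin r}
    {S : Sym2 (Fin r) → Prop} {blk : Fin r → ι} (hfit : BlocksFit S blk) {p a k R : ℝ}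
    (hR : (r : ℝ) ≤ R) (hR0 : 0 < R) (ha : 0 < a) (hak : a / R ≤ k / 2) (hp : 0 ≤ p)
    {G : SimpleGraph V} (hG : GoodGraph part S p ((a / R) ^ 2) G) {X : Finset V}
    (hdeg : ∀ v ∈ X, 2 * a ≤ (X.filter fun w => (relGraph part S G).Adj v w).card)
    (hrich : ∀ j, k ≤ (X.filter fun v => part v = j).card)
    {κ : ℝ} (hκ0 : 0 ≤ κ) (hκa : κ ≤ a) (hκ : κ * Fintype.card V ≤ p / 4 * (a / R) ^ 2)
    (i : ι) :
    Robust (relGraph part S G) κ (X.filter fun v => blk (part v) = i) := by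
  refine robust_of_degree_of_cut (d := 2 * a) (m := κ) ?_ ?_ hκ0 (by linarith) le_rfl
  · intro v hv
    rw [Finset.mem_filter] at hv
    refine (hdeg v hv.1).trans (Nat.cast_le.2 (Finset.card_le_card fun w hw => ?_))
    simp only [Finset.mem_filter] at hw ⊢
    exact ⟨⟨hw.1, (hfit.eq_of_rel _ _ hw.2.2).symm.trans hv.2⟩, hw.2⟩
  · intro T hT h1 h2
    have hrel := hfit.le_card_relPairs (part := part)
      (X := X.filter fun v => blk (part v) = i) (i := i)
      (fun v hv => (Finset.mem_filter.1 hv).2) hR hR0 ha hak (fun j hj => by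
        refine (hrich j).trans (Nat.cast_le.2 (Finset.card_le_card fun v hv => ?_))
        simp only [Finset.mem_filter] at hv ⊢
        exact ⟨⟨hv.1, by rw [hv.2, hj]⟩, hv.2⟩) hT (by linarith) (by linarith)
    refine le_trans ?_ (hG.dense T _ Finset.disjoint_sdiff hrel)
    calc κ * (X.filter fun v => blk (part v) = i).card ≤ κ * Fintype.card V :=
          mul_le_mul_of_nonneg_left (Nat.cast_le.2 (Finset.card_le_univ _)) hκ0
      _ ≤ p / 4 * (a / R) ^ 2 := hκ
      _ ≤ _ := mul_le_mul_of_nonneg_left hrel (by linarith)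

/-! ### Reaching the constant configuration on a good graph -/

open Classical in
-- The Markov property, used to chain the phases.
theorem mul_le_sum_pow_transition {V : Type*} [Fintype V] {G : SimpleGraph V} {β : Sym2 V → ℝ}
    (hβ : Ferromagnetic G β) {γ : V → ℝ} {s t : ℕ} {σ : V → Bool} {A : (V → Bool) → Prop}
    {f : (V → Bool) → ℝ} (hf : ∀ τ, 0 ≤ f τ) {x y : ℝ} (hy : 0 ≤ y)
    (hx : x ≤ ∑ ρ, (transition G β γ ^ s) σ ρ * ind (A ρ))
    (hA : ∀ ρ, A ρ → y ≤ ∑ τ, (transition G β γ ^ t) ρ τ * f τ) :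
    x * y ≤ ∑ τ, (transition G β γ ^ (s + t)) σ τ * f τ := by
  calc x * y ≤ (∑ ρ, (transition G β γ ^ s) σ ρ * ind (A ρ)) * y :=
        mul_le_mul_of_nonneg_right hx hy
    _ = ∑ ρ, (transition G β γ ^ s) σ ρ * (ind (A ρ) * y) := by
        simp only [Finset.sum_mul, mul_assoc]
    _ ≤ ∑ ρ, (transition G β γ ^ s) σ ρ * ∑ τ, (transition G β γ ^ t) ρ τ * f τ := by
        refine Finset.sum_le_sum fun ρ _ =>
          mul_le_mul_of_nonneg_left ?_ (pow_transition_nonneg hβ γ s σ ρ)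
        by_cases h : A ρ
        · rw [ind_of h, one_mul]
          exact hA ρ h
        · rw [ind_of_not h, zero_mul]
          exact Finset.sum_nonneg fun τ _ => mul_nonneg (pow_transition_nonneg hβ γ t ρ τ) (hf τ)
    _ = _ := by
        simp only [pow_add, Matrix.mul_apply, Finset.sum_mul, Finset.mul_sum, mul_assoc]
        exact Finset.sum_comm

theorem strongIn_relGraph {V : Type*} {r : ℕ} {part : V → Fin r} {S : Sym2 (Fin r) → Prop}
    {G : SimpleGraph V} {β : Sym2 V → ℝ} {b : ℝ}
    (h : ∀ e ∈ G.edgeSet, S (e.map part) → b ≤ β e) : StrongIn G β b (relGraph part S G) := by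
  intro e he
  induction e with
  | h u v => exact ⟨he.1, h _ he.1 he.2⟩

open Classical in
theorem le_card_relPairs_compl {V : Type*} [Fintype V] {r : ℕ} {part : V → Fin r}
    {S : Sym2 (Fin r) → Prop} (hS : ∀ j, ∃ l, S s(j, l)) {k : ℝ} (hk1 : 1 ≤ k)
    (hk : ∀ j, 2 * k ≤ (Finset.univ.filter fun v => part v = j).card) (v : V) :
    k ≤ (relPairs part S {v} {v}ᶜ).card := by
  obtain ⟨l, hl⟩ := hS (part v)
  have h1 : (Finset.univ.filter fun v => part v = l).card ≤
      (relPairs part S {v} {v}ᶜ).card + 1 := by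
    rw [card_relPairs, Finset.sum_singleton]
    refine (Finset.card_le_card (t := insert v _) fun w hw => ?_).trans
      (Finset.card_insert_le v _)
    rw [Finset.mem_insert, Finset.mem_filter, Finset.mem_compl, Finset.mem_singleton]
    by_cases hwv : w = v
    · exact Or.inl hwv
    · exact Or.inr ⟨hwv, by rw [(Finset.mem_filter.1 hw).2]; exact hl⟩
  have h2 : ((Finset.univ.filter fun v => part v = l).card : ℝ) ≤
      (relPairs part S {v} {v}ᶜ).card + 1 := by exact_mod_cast h1
  linarith [hk l]

open Classical in
theorem GoodGraph.le_degree {V : Type*} [Fintype V] {r : ℕ} {part : V → Fin r}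
    {S : Sym2 (Fin r) → Prop} {p m k : ℝ} {G : SimpleGraph V} (hG : GoodGraph part S p m G)
    (hp : 0 ≤ p) (hS : ∀ j, ∃ l, S s(j, l)) (hk1 : 1 ≤ k)
    (hk : ∀ j, 2 * k ≤ (Finset.univ.filter fun v => part v = j).card) (v : V) :
    p * k / 4 ≤ (Finset.univ.filter fun w => (relGraph part S G).Adj v w).card := by
  have h3 := hG.degree v
  rw [card_edgesBetween, Finset.sum_singleton] at h3
  have h4 : (((({v} : Finset V)ᶜ).filter fun w => (relGraph part S G).Adj v w).card : ℝ) ≤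
      (Finset.univ.filter fun w => (relGraph part S G).Adj v w).card :=
    Nat.cast_le.2 (Finset.card_le_card (Finset.filter_subset_filter _ (Finset.subset_univ _)))
  have h5 : p / 4 * k ≤ p / 4 * (relPairs part S {v} {v}ᶜ).card :=
    mul_le_mul_of_nonneg_left (le_card_relPairs_compl hS hk1 hk v) (by linarith)
  linarith

open Classical in
/-- On a good graph, from a configuration in which every part has many favoured spins, the chain
becomes constant equal to the favoured spin with probability bounded below. -/
theorem GoodGraph.le_pow_transition_of_rich {V ι : Type*} [Fintype V] [Fintype ι] {r R : ℕ}
    {part : V → Fin r} {S : Sym2 (Fin r) → Prop} {blk : Fin r → ι} (hfit : BlocksFit S blk)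
    (hr : r ≤ R) (hR : 1 ≤ R) {p k a κ b η : ℝ} (hp0 : 0 < p) (hp1 : p ≤ 1)
    (hak : a = p * k / 32) (ha : 1 ≤ a)
    (hk : ∀ j, 2 * k ≤ (Finset.univ.filter fun v => part v = j).card)
    {G : SimpleGraph V} (hG : GoodGraph part S p ((a / R) ^ 2) G)
    (hκ0 : 0 ≤ κ) (hκa : κ ≤ a) (hκ : κ * Fintype.card V ≤ p / 4 * (a / R) ^ 2)
    {β : Sym2 V → ℝ} (hβ : Ferromagnetic G β) (hb : 0 ≤ b)
    (hs : ∀ e ∈ G.edgeSet, S (e.map part) → b ≤ β e) {γ : V → ℝ} {z : Bool}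
    (hz : Favours γ z) {t : ℕ}
    (hη : R * (2 * ((1 + Real.exp (-2 * b * κ)) ^ Fintype.card V - 1)) ≤ η)
    (hη0 : 0 ≤ η) (htη : t * η ≤ 1 / 4) (hηR : η ≤ (1 / 2) ^ (R + 1))
    (ht : (1 / 2 : ℝ) ^ t * Fintype.card V ≤ 1 / 4) {σ : V → Bool}
    (hσ : ∀ j, k ≤ (Finset.univ.filter fun v => part v = j ∧ σ v = z).card) :
    1 / 2 * (1 / 2 * (1 / 2) ^ (R + 1)) ≤
      (transition G β γ ^ (t + (t + 1))) σ (fun _ => z) := by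
  -- With this a, vertices outside L have at least pk/8 = 4a neighbours in B and all vertices have
  -- at least pk/4 = 8a neighbours. Losing |L| < a of them leaves more than the 2a required for
  -- robustness.
  have hk32 : 32 * a = p * k := by rw [hak]; ring
  have hk0 : 0 < k := by
    by_contra hneg
    push Not at hneg
    nlinarith
  have hak' : 32 * a ≤ k := by rw [hk32]; nlinarith
  have hR' : (1 : ℝ) ≤ R := by exact_mod_cast hR
  have haR : a / R ≤ a := div_le_self (by linarith) hR'
  have haR0 : 0 ≤ a / R := by positivity
  have hst : StrongIn G β b (relGraph part S G) := strongIn_relGraph hs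
  have hι : Fintype.card ι ≤ R :=
    (by simpa using Fintype.card_le_of_surjective blk hfit.surjective : Fintype.card ι ≤ r).trans hr
  have hη' : Fintype.card ι * (2 * ((1 + Real.exp (-2 * b * κ)) ^ Fintype.card V - 1)) ≤ η := by
    refine le_trans (mul_le_mul_of_nonneg_right (Nat.cast_le.2 hι) ?_) hη
    have : 1 ≤ (1 + Real.exp (-2 * b * κ)) ^ Fintype.card V :=
      one_le_pow₀ (by linarith [Real.exp_pos (-2 * b * κ)])
    linarith
  set B := Finset.univ.filter fun v => σ v = z with hB
  set N := relGraph part S G with hN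
  set L := Finset.univ.filter fun v =>
    ((B.filter fun w => N.Adj v w).card : ℝ) < p * k / 8 with hL
  have hLcard : (L.card : ℝ) < a := by
    refine hG.card_low_degree_lt (B := B) (k := k) (fun v => ?_) ha (by linarith) ?_ hp0.le
    · obtain ⟨l, hl⟩ := hfit.exists_rel (part v)
      refine (hσ l).trans (Nat.cast_le.2 (Finset.card_le_card fun w hw => ?_))
      simp only [hB, Finset.mem_filter, Finset.mem_univ, true_and] at hw ⊢
      exact ⟨hw.2, by rw [hw.1]; exact hl⟩
    · calc (a / R) ^ 2 ≤ a ^ 2 := pow_le_pow_left₀ haR0 haR 2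
        _ ≤ a * (k / 2) := by rw [pow_two]; nlinarith
  set W := Lᶜ with hW
  set U := W ∩ B with hU
  have hBU : B \ U ⊆ L := fun v hv => by
    simp only [hU, hW, Finset.mem_sdiff, Finset.mem_inter, Finset.mem_compl] at hv
    by_contra h
    exact hv.2 ⟨h, hv.1⟩
  have hUrich : ∀ j, k / 2 ≤ (U.filter fun v => part v = j).card := by
    intro j
    have := card_filter_le_add_card_sdiff (fun v => part v = j) hBU
    have h2 := hσ j
    have h3 : (Finset.univ.filter fun v => part v = j ∧ σ v = z) =
        B.filter fun v => part v = j := by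
      ext v
      simp [hB, and_comm]
    rw [h3] at h2
    linarith
  have hrob : ∀ X, U ⊆ X →
      (∀ v ∈ X, 2 * a ≤ (X.filter fun w => N.Adj v w).card) → ∀ i,
      Robust N κ (X.filter fun v => blk (part v) = i) := by
    intro X hX hdeg i
    refine hG.robust hfit (k := k / 2) (R := R) (Nat.cast_le.2 hr) (by linarith) (by linarith)
      (by linarith) hp0.le hdeg (fun j => (hUrich j).trans ?_) hκ0 hκa hκ i
    exact Nat.cast_le.2 (Finset.card_le_card (Finset.filter_subset_filter _ hX))
  have hc : ∀ i, ∃ v ∈ U, blk (part v) = i := by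
    intro i
    obtain ⟨j, rfl⟩ := hfit.surjective i
    have : (0 : ℝ) < (U.filter fun v => part v = j).card := by linarith [hUrich j]
    obtain ⟨v, hv⟩ := Finset.card_pos.1 (by exact_mod_cast this)
    rw [Finset.mem_filter] at hv
    exact ⟨v, hv.1, by rw [hv.2]⟩
  choose c hcU hcblk using hc
  -- The 1/2 is what remains of 1 after two losses of at most 1/4: disagreements left over, and
  -- failed percolation in one of the t steps.
  have growth : ∀ (Y Z : Finset V) (ρ : V → Bool), U ⊆ Y → Y ⊆ Z →
      (∀ X, Y ⊆ X → X ⊆ Z → ∀ v ∈ X, 2 * a ≤ (X.filter fun w => N.Adj v w).card) →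
      (∀ v ∈ Y, ρ v = ρ (c (blk (part v)))) →
      1 / 2 ≤ ∑ τ, (transition G β γ ^ t) ρ τ *
        ind (∀ v ∈ Z, τ v = τ (c (blk (part v)))) := by
    intro Y Z ρ hUY hYZ hdeg hρ
    have h := le_pow_transition_constant (blk := fun v => blk (part v)) (c := c) hβ hz hb hst
      (fun i => ⟨hUY (hcU i), hcblk i⟩) hYZ
      (fun X hYX hXZ i => hrob X (hUY.trans hYX) (hdeg X hYX hXZ) i) hη' hη0 t ρ hρ
    refine le_trans ?_ h
    have h2 : ((Z.filter fun v => ρ v ≠ ρ (c (blk (part v)))).card : ℝ) ≤ Fintype.card V :=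
      Nat.cast_le.2 (Finset.card_le_univ _)
    have h3 : (1 / 2 : ℝ) ^ t * (Z.filter fun v => ρ v ≠ ρ (c (blk (part v)))).card ≤
        (1 / 2 : ℝ) ^ t * Fintype.card V := mul_le_mul_of_nonneg_left h2 (by positivity)
    linarith
  have hUW : U ⊆ W := Finset.inter_subset_left
  have step1 := growth U W σ subset_rfl hUW
    (fun X hUX hXW v hv => by
      have h1 : p * k / 8 ≤ ((B.filter fun w => N.Adj v w).card : ℝ) := by
        have := hXW hv
        simpa [hW, hL] using this
      have h2 := card_filter_le_add_card_sdiff (X := X) (Y := B) (Z := L) (fun w => N.Adj v w)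
        (fun w hw => hBU (Finset.mem_sdiff.2
          ⟨(Finset.mem_sdiff.1 hw).1, fun h => (Finset.mem_sdiff.1 hw).2 (hUX h)⟩))
      linarith)
    (fun v hv => by
      have hBz : ∀ v ∈ U, σ v = z := fun v hv =>
        (Finset.mem_filter.1 (Finset.mem_inter.1 hv).2).2
      rw [hBz v hv, hBz _ (hcU _)])
  -- Two phases are needed because vertices of L may have few neighbours in B; they do have many in
  -- W, whose complement L is small.
  have step2 : ∀ ρ, (∀ v ∈ W, ρ v = ρ (c (blk (part v)))) → 1 / 2 ≤
      ∑ τ, (transition G β γ ^ t) ρ τ *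
        ind (∀ v ∈ Finset.univ, τ v = τ (c (blk (part v)))) := fun ρ hρ =>
    growth W Finset.univ ρ hUW (Finset.subset_univ _)
      (fun X hWX _ v _ => by
        have h1 := hG.le_degree hp0.le hfit.exists_rel (by linarith) hk v
        have h2 := card_filter_le_add_card_sdiff (X := X) (Y := Finset.univ) (Z := L)
          (fun w => N.Adj v w) (fun w hw => by
            by_contra h
            exact (Finset.mem_sdiff.1 hw).2 (hWX (Finset.mem_compl.2 h)))
        linarith) hρ
  have step3 : ∀ ρ : V → Bool, (∀ v ∈ Finset.univ, ρ v = ρ (c (blk (part v)))) →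
      (1 / 2) ^ (R + 1) ≤ ∑ τ, (transition G β γ ^ 1) ρ τ * ind (τ = fun _ => z) := by
    intro ρ hρ
    have h := le_transition_const_of_constant (blk := fun v => blk (part v)) (c := c) hβ hz hb
      hst hcblk (fun i => hrob Finset.univ (Finset.subset_univ _) (fun v _ => by
        have h1 := hG.le_degree hp0.le hfit.exists_rel (by linarith) hk v
        linarith) i) (σ := ρ) (fun v => hρ v (Finset.mem_univ v))
    have h2 : (1 / 2 : ℝ) ^ R ≤ (1 / 2) ^ Fintype.card ι :=
      pow_le_pow_of_le_one (by norm_num) (by norm_num) hι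
    have h3 : (1 / 2 : ℝ) ^ (R + 1) = (1 / 2) ^ R * (1 / 2) := pow_succ _ _
    have h4 : ∑ τ, (transition G β γ ^ 1) ρ τ * ind (τ = fun _ => z) =
        transition G β γ ρ fun _ => z := by
      simp [ind]
    rw [h4]
    linarith
  have key := mul_le_sum_pow_transition hβ (fun _ => ind_nonneg _) (by positivity) step1
    fun ρ hρ => mul_le_sum_pow_transition hβ (fun _ => ind_nonneg _) (by positivity)
      (step2 ρ hρ) step3
  simpa [ind] using key

open Classical in
theorem GoodGraph.le_pow_transition {V ι : Type*} [Fintype V] [Fintype ι] {r R : ℕ}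
    {part : V → Fin r} {S : Sym2 (Fin r) → Prop} {blk : Fin r → ι} (hfit : BlocksFit S blk)
    (hr : r ≤ R) (hR : 1 ≤ R) {p k a κ b η : ℝ} (hp0 : 0 < p) (hp1 : p ≤ 1)
    (hak : a = p * k / 32) (ha : 1 ≤ a)
    (hk : ∀ j, k ≤ (1 / 2 : ℝ) ^ (R + 1) * (Finset.univ.filter fun v => part v = j).card)
    {G : SimpleGraph V} (hG : GoodGraph part S p ((a / R) ^ 2) G)
    (hκ0 : 0 ≤ κ) (hκa : κ ≤ a) (hκ : κ * Fintype.card V ≤ p / 4 * (a / R) ^ 2)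
    {β : Sym2 V → ℝ} (hβ : Ferromagnetic G β) (hb : 0 ≤ b)
    (hs : ∀ e ∈ G.edgeSet, S (e.map part) → b ≤ β e) {γ : V → ℝ} {z : Bool}
    (hz : Favours γ z) {t : ℕ}
    (hη : R * (2 * ((1 + Real.exp (-2 * b * κ)) ^ Fintype.card V - 1)) ≤ η)
    (hη0 : 0 ≤ η) (htη : t * η ≤ 1 / 4) (hηR : η ≤ (1 / 2) ^ (R + 1))
    (ht : (1 / 2 : ℝ) ^ t * Fintype.card V ≤ 1 / 4) (σ : V → Bool) :
    (1 / 2) ^ (2 * R + 4) ≤ (transition G β γ ^ (1 + (t + (t + 1)))) σ (fun _ => z) := by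
  have hk0 : 0 < k := by
    by_contra hneg
    push Not at hneg
    nlinarith
  have hcard : ∀ j, (0 : ℝ) < (Finset.univ.filter fun v => part v = j).card := by
    intro j
    by_contra hneg
    push Not at hneg
    have h1 := hk j
    have : (0 : ℝ) < (1 / 2) ^ (R + 1) := by positivity
    nlinarith
  have hRr : (1 / 2 : ℝ) ^ (R + 1) ≤ (1 / 2) ^ (r + 1) :=
    pow_le_pow_of_le_one (by norm_num) (by norm_num) (by omega)
  have step := le_transition_rich hβ hz part (fun j => by
    obtain ⟨v, hv⟩ := Finset.card_pos.1 (by exact_mod_cast hcard j)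
    exact ⟨v, (Finset.mem_filter.1 hv).2⟩) σ
  rw [← pow_one (transition G β γ)] at step
  have key := mul_le_sum_pow_transition (t := t + (t + 1)) hβ
    (f := fun τ => ind (τ = fun _ => z)) (fun _ => ind_nonneg _) (by positivity) step
    (y := 1 / 2 * (1 / 2 * (1 / 2) ^ (R + 1))) fun ρ hρ => by
      have h := hG.le_pow_transition_of_rich hfit hr hR hp0 hp1 hak ha (fun j => ?_) hκ0 hκa hκ
        hβ hb hs hz hη hη0 htη hηR ht (σ := ρ) fun j => ?_
      · simpa [ind] using h
      · have h1 : (1 / 2 : ℝ) ^ (R + 1) ≤ 1 / 2 :=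
          pow_le_of_le_one (by norm_num) (by norm_num) (by omega)
        nlinarith [hk j, hcard j]
      · exact (hk j).trans ((mul_le_mul_of_nonneg_right hRr (hcard j).le).trans (hρ j))
  have hfin : (1 / 2 : ℝ) ^ (2 * R + 4) ≤
      (1 / 2) ^ (r + 1) * (1 / 2 * (1 / 2 * (1 / 2) ^ (R + 1))) := by
    calc (1 / 2 : ℝ) ^ (2 * R + 4) = (1 / 2) ^ (R + 1) * (1 / 2 * (1 / 2 * (1 / 2) ^ (R + 1))) := by
          ring
      _ ≤ _ := mul_le_mul_of_nonneg_right hRr (by positivity)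
  refine hfin.trans (key.trans (le_of_eq ?_))
  simp [ind]

/-! ### The random graph is good with high probability -/

open Classical in
theorem sum_simpleGraph_prod {V : Type*} [Fintype V] (x y : Sym2 V → ℝ) :
    ∑ G : SimpleGraph V, ∏ e : Sym2 V with ¬ e.IsDiag, (if e ∈ G.edgeSet then x e else y e) =
      ∏ e : Sym2 V with ¬ e.IsDiag, (x e + y e) := by
  rw [Finset.prod_add]
  refine Finset.sum_bij' (fun G _ => Finset.univ.filter fun e => ¬ e.IsDiag ∧ e ∈ G.edgeSet)
    (fun t _ => SimpleGraph.fromEdgeSet (t : Set (Sym2 V))) ?_ ?_ ?_ ?_ ?_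
  · intro G _
    rw [Finset.mem_powerset]
    intro e he
    simp only [Finset.mem_filter, Finset.mem_univ, true_and] at he ⊢
    exact he.1
  · intro t _
    exact Finset.mem_univ _
  · intro G _
    ext u v
    simp only [SimpleGraph.fromEdgeSet_adj, Finset.coe_filter, Finset.mem_univ, true_and,
      Set.mem_ofPred_eq, SimpleGraph.mem_edgeSet]
    exact ⟨fun h => h.1.2, fun h => ⟨⟨by simpa using h.ne, h⟩, h.ne⟩⟩
  · intro t ht
    ext e
    rw [Finset.mem_powerset] at ht
    simp only [Finset.mem_filter, Finset.mem_univ, true_and, SimpleGraph.edgeSet_fromEdgeSet,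
      Set.mem_sdiff, Finset.mem_coe]
    constructor
    · exact fun h => h.2.1
    · intro h
      have := (Finset.mem_filter.1 (ht h)).2
      exact ⟨this, h, this⟩
  · intro G _
    rw [Finset.prod_ite]
    congr 1
    · rw [Finset.filter_filter]
    · congr 1
      ext e
      simp only [Finset.mem_filter, Finset.mem_univ, true_and, Finset.mem_sdiff]
      tauto

theorem graphWeight_nonneg {V : Type*} [Fintype V] {r : ℕ} (part : V → Fin r)
    {p : Sym2 (Fin r) → ℝ} (hp : ∀ e, 0 ≤ p e ∧ p e ≤ 1) (G : SimpleGraph V) :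
    0 ≤ graphWeight part p G := by
  refine Finset.prod_nonneg fun e _ => ?_
  split_ifs
  · exact (hp _).1
  · exact sub_nonneg.2 (hp _).2

open Classical in
theorem graphProb_eq {V : Type*} [Fintype V] {r : ℕ} (part : V → Fin r)
    (p : Sym2 (Fin r) → ℝ) (Q : SimpleGraph V → Prop) :
    graphProb part p Q = ∑ G, graphWeight part p G * ind (Q G) := by
  rw [graphProb, Finset.sum_filter]
  refine Finset.sum_congr rfl fun G _ => ?_
  rw [ind, mul_ite, mul_one, mul_zero]

open Classical in
theorem sum_graphWeight {V : Type*} [Fintype V] {r : ℕ} (part : V → Fin r)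
    (p : Sym2 (Fin r) → ℝ) : ∑ G, graphWeight part p G = 1 := by
  simp only [graphWeight]
  rw [sum_simpleGraph_prod]
  simp

theorem graphProb_mono {V : Type*} [Fintype V] {r : ℕ} (part : V → Fin r)
    {p : Sym2 (Fin r) → ℝ} (hp : ∀ e, 0 ≤ p e ∧ p e ≤ 1) {Q R : SimpleGraph V → Prop}
    (h : ∀ G, Q G → R G) : graphProb part p Q ≤ graphProb part p R := by
  rw [graphProb_eq, graphProb_eq]
  exact Finset.sum_le_sum fun G _ =>
    mul_le_mul_of_nonneg_left (ind_mono (h G)) (graphWeight_nonneg part hp G)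

theorem graphProb_eq_one {V : Type*} [Fintype V] {r : ℕ} (part : V → Fin r)
    (p : Sym2 (Fin r) → ℝ) {Q : SimpleGraph V → Prop} (h : ∀ G, Q G) :
    graphProb part p Q = 1 := by
  rw [graphProb_eq, ← sum_graphWeight part p]
  exact Finset.sum_congr rfl fun G _ => by rw [ind_of (h G), mul_one]

theorem one_sub_sum_le_graphProb {V κ : Type*} [Fintype V] {r : ℕ} (part : V → Fin r)
    {p : Sym2 (Fin r) → ℝ} (hp : ∀ e, 0 ≤ p e ∧ p e ≤ 1) {Q : SimpleGraph V → Prop}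
    (A : Finset κ) {R : κ → SimpleGraph V → Prop} (h : ∀ G, ¬ Q G → ∃ k ∈ A, R k G) :
    1 - ∑ k ∈ A, graphProb part p (R k) ≤ graphProb part p Q := by
  rw [sub_le_iff_le_add, ← sum_graphWeight part p]
  simp only [graphProb_eq]
  rw [Finset.sum_comm, ← Finset.sum_add_distrib]
  refine Finset.sum_le_sum fun G _ => ?_
  rw [← Finset.mul_sum, ← mul_add]
  refine le_mul_of_one_le_right (graphWeight_nonneg part hp G) ?_
  by_cases hQ : Q G
  · rw [ind_of hQ]
    have := Finset.sum_nonneg (s := A) fun k _ => ind_nonneg (R k G)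
    linarith
  · obtain ⟨k, hk, hR⟩ := h G hQ
    rw [ind_of_not hQ, zero_add, ← ind_of hR]
    exact Finset.single_le_sum (f := fun k => ind (R k G)) (fun _ _ => ind_nonneg _) hk

open Classical in
/-- A Chernoff bound for the number of edges among a set of pairs. -/
theorem graphProb_card_lt_le {V : Type*} [Fintype V] {r : ℕ} (part : V → Fin r)
    {p : Sym2 (Fin r) → ℝ} (hp : ∀ e, 0 ≤ p e ∧ p e ≤ 1) {p₀ : ℝ}
    {F : Finset (Sym2 V)} (hF : ∀ e ∈ F, ¬ e.IsDiag ∧ p₀ ≤ p (e.map part)) :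
    graphProb part p (fun G => ((F.filter fun e => e ∈ G.edgeSet).card : ℝ) < p₀ / 4 * F.card) ≤
      Real.exp (-(p₀ / 4 * F.card)) := by
  have hFN : F ⊆ Finset.univ.filter fun e : Sym2 V => ¬ e.IsDiag := fun e he =>
    Finset.mem_filter.2 ⟨Finset.mem_univ _, (hF e he).1⟩
  have h1 : ∀ G : SimpleGraph V, graphWeight part p G *
      ind (((F.filter fun e => e ∈ G.edgeSet).card : ℝ) < p₀ / 4 * F.card) ≤
      Real.exp (p₀ / 4 * F.card) * ∏ e : Sym2 V with ¬ e.IsDiag,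
        (if e ∈ G.edgeSet then p (e.map part) * (if e ∈ F then Real.exp (-1) else 1)
          else 1 - p (e.map part)) := by
    intro G
    have e1 : ∏ e : Sym2 V with ¬ e.IsDiag,
        (if e ∈ G.edgeSet then p (e.map part) * (if e ∈ F then Real.exp (-1) else 1)
          else 1 - p (e.map part)) =
        graphWeight part p G * Real.exp (-((F.filter fun e => e ∈ G.edgeSet).card : ℝ)) := by
      have e2 : Real.exp (-((F.filter fun e => e ∈ G.edgeSet).card : ℝ)) =
          ∏ e : Sym2 V with ¬ e.IsDiag,
            (if e ∈ F.filter fun e => e ∈ G.edgeSet then Real.exp (-1) else 1) := by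
        rw [Finset.prod_ite_mem, Finset.inter_eq_right.2 ((Finset.filter_subset _ _).trans hFN),
          Finset.prod_const, ← Real.exp_nat_mul]
        congr 1
        ring
      rw [e2, graphWeight, ← Finset.prod_mul_distrib]
      refine Finset.prod_congr rfl fun e _ => ?_
      by_cases he : e ∈ G.edgeSet <;> simp [he]
    rw [e1, mul_left_comm, ← Real.exp_add]
    refine mul_le_mul_of_nonneg_left ?_ (graphWeight_nonneg part hp G)
    by_cases h : ((F.filter fun e => e ∈ G.edgeSet).card : ℝ) < p₀ / 4 * F.card
    · rw [ind_of h]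
      exact Real.one_le_exp (by linarith)
    · rw [ind_of_not h]
      exact (Real.exp_pos _).le
  rw [graphProb_eq]
  refine (Finset.sum_le_sum fun G _ => h1 G).trans ?_
  rw [← Finset.mul_sum, sum_simpleGraph_prod]
  -- Exponential Markov inequality: each pair of F contributes 1 - p(1 - 1/e) ≤ 1 - p₀/2 ≤ exp
  -- (-p₀/2), which leaves exp (-p₀/4) per pair after the prefactor.
  have h2 : ∏ e : Sym2 V with ¬ e.IsDiag,
      (p (e.map part) * (if e ∈ F then Real.exp (-1) else 1) + (1 - p (e.map part))) ≤
      ∏ e ∈ F, Real.exp (-(p₀ / 2)) := by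
    rw [← Finset.prod_subset hFN]
    · refine Finset.prod_le_prod (fun e he => ?_) fun e he => ?_
      · have := hp (e.map part)
        have := mul_nonneg (hp (e.map part)).1 (Real.exp_pos (-1)).le
        simp only [he, if_true]
        linarith
      · simp only [he, if_true]
        have h3 : Real.exp (-1) ≤ 1 / 2 := by
          have := Real.exp_one_gt_d9
          rw [Real.exp_neg, inv_eq_one_div]
          exact one_div_le_one_div_of_le (by norm_num) (by linarith)
        have h4 := Real.add_one_le_exp (-(p₀ / 2))
        have h5 := (hF e he).2
        nlinarith [mul_le_mul_of_nonneg_left h3 (hp (e.map part)).1]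
    · intro e _ he
      simp [he]
  refine (mul_le_mul_of_nonneg_left h2 (Real.exp_pos _).le).trans (le_of_eq ?_)
  rw [Finset.prod_const, ← Real.exp_nat_mul, ← Real.exp_add]
  congr 1
  ring

open Classical in
theorem graphProb_edgesBetween_lt_le {V : Type*} [Fintype V] {r : ℕ} (part : V → Fin r)
    {p : Sym2 (Fin r) → ℝ} (hp : ∀ e, 0 ≤ p e ∧ p e ≤ 1) {p₀ : ℝ}
    {S : Sym2 (Fin r) → Prop} (hS : ∀ e, S e → p₀ ≤ p e) {T U : Finset V} (hTU : Disjoint T U) :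
    graphProb part p (fun G => ((edgesBetween (relGraph part S G) T U).card : ℝ) <
      p₀ / 4 * (relPairs part S T U).card) ≤
      Real.exp (-(p₀ / 4 * (relPairs part S T U).card)) := by
  set F := (relPairs part S T U).image fun x : V × V => s(x.1, x.2) with hF
  have hsub : (relPairs part S T U : Set (V × V)) ⊆ (T ×ˢ U : Finset (V × V)) := by
    exact_mod_cast Finset.filter_subset _ _
  have hcard : F.card = (relPairs part S T U).card :=
    Finset.card_image_of_injOn ((sym2Mk_injOn hTU).mono hsub)
  have hcard2 : ∀ G : SimpleGraph V, (F.filter fun e => e ∈ G.edgeSet).card =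
      (edgesBetween (relGraph part S G) T U).card := by
    intro G
    have : edgesBetween (relGraph part S G) T U =
        (relPairs part S T U).filter fun x => s(x.1, x.2) ∈ G.edgeSet := by
      ext x
      simp only [edgesBetween, relPairs, Finset.mem_filter, SimpleGraph.mem_edgeSet, relGraph,
        and_assoc, and_comm (a := G.Adj _ _)]
    rw [this, hF, Finset.filter_image, Finset.card_image_of_injOn]
    exact ((sym2Mk_injOn hTU).mono hsub).mono (by exact_mod_cast Finset.filter_subset _ _)
  have h := graphProb_card_lt_le part hp (F := F) (by
    intro e he
    obtain ⟨⟨u, v⟩, huv, rfl⟩ := Finset.mem_image.1 he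
    simp only [relPairs, Finset.mem_filter, Finset.mem_product] at huv
    refine ⟨?_, hS _ huv.2⟩
    rw [Sym2.mk_isDiag_iff]
    intro (h : u = v)
    exact Finset.disjoint_left.1 hTU huv.1.1 (h ▸ huv.1.2))
  simpa only [hcard, hcard2] using h

open Classical in
-- A union bound over the dense pairs of sets, at most 4^n of them, and over the n stars, with a
-- Chernoff bound for each.
theorem one_sub_le_graphProb_goodGraph {V : Type*} [Fintype V] {r : ℕ} (part : V → Fin r)
    {p : Sym2 (Fin r) → ℝ} (hp : ∀ e, 0 ≤ p e ∧ p e ≤ 1) {p₀ : ℝ} (hp₀ : 0 ≤ p₀)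
    {S : Sym2 (Fin r) → Prop} (hS : ∀ e, S e → p₀ ≤ p e) (hS' : ∀ j, ∃ l, S s(j, l))
    {m k : ℝ} (hk1 : 1 ≤ k)
    (hk : ∀ j, 2 * k ≤ (Finset.univ.filter fun v => part v = j).card) :
    1 - (4 ^ Fintype.card V * Real.exp (-(p₀ / 4 * m)) +
      Fintype.card V * Real.exp (-(p₀ / 4 * k))) ≤
      graphProb part p (GoodGraph part S p₀ m) := by
  set A : Finset (Finset V × Finset V) :=
    Finset.univ.filter fun x => Disjoint x.1 x.2 ∧ m ≤ (relPairs part S x.1 x.2).card with hA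
  set D : Finset (Finset V × Finset V) := Finset.univ.image fun v : V => ({v}, {v}ᶜ) with hD
  have h := one_sub_sum_le_graphProb part hp (Q := GoodGraph part S p₀ m) (A ∪ D)
    (R := fun x G => ((edgesBetween (relGraph part S G) x.1 x.2).card : ℝ) <
      p₀ / 4 * (relPairs part S x.1 x.2).card) (by
    intro G hG
    by_contra hcon
    push Not at hcon
    refine hG ⟨fun T U hTU hm => ?_, fun v => ?_⟩
    · exact hcon (T, U) (Finset.mem_union_left _ (by simp [hA, hTU, hm]))
    · exact hcon ({v}, {v}ᶜ) (Finset.mem_union_right _ (Finset.mem_image_of_mem _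
        (Finset.mem_univ v))))
  refine le_trans (sub_le_sub_left ?_ 1) h
  have hbound : ∀ x ∈ A ∪ D, graphProb part p (fun G =>
      ((edgesBetween (relGraph part S G) x.1 x.2).card : ℝ) <
      p₀ / 4 * (relPairs part S x.1 x.2).card) ≤
      Real.exp (-(p₀ / 4 * (relPairs part S x.1 x.2).card)) := by
    intro x hx
    refine graphProb_edgesBetween_lt_le part hp hS ?_
    rcases Finset.mem_union.1 hx with hx | hx
    · exact (Finset.mem_filter.1 hx).2.1
    · obtain ⟨v, -, rfl⟩ := Finset.mem_image.1 hx
      exact disjoint_compl_right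
  refine (Finset.sum_le_sum hbound).trans ?_
  have hunion : ∑ x ∈ A ∪ D, Real.exp (-(p₀ / 4 * (relPairs part S x.1 x.2).card)) ≤
      ∑ x ∈ A, Real.exp (-(p₀ / 4 * (relPairs part S x.1 x.2).card)) +
      ∑ x ∈ D, Real.exp (-(p₀ / 4 * (relPairs part S x.1 x.2).card)) := by
    rw [← Finset.sum_union_inter]
    exact le_add_of_nonneg_right (Finset.sum_nonneg fun _ _ => (Real.exp_pos _).le)
  refine hunion.trans (add_le_add ?_ ?_)
  · calc _ ≤ ∑ x ∈ A, Real.exp (-(p₀ / 4 * m)) := by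
          refine Finset.sum_le_sum fun x hx => Real.exp_le_exp.2 (neg_le_neg ?_)
          exact mul_le_mul_of_nonneg_left (Finset.mem_filter.1 hx).2.2 (by linarith)
      _ = A.card * Real.exp (-(p₀ / 4 * m)) := by rw [Finset.sum_const, nsmul_eq_mul]
      _ ≤ _ := by
          refine mul_le_mul_of_nonneg_right ?_ (Real.exp_pos _).le
          have h1 : A.card ≤ 4 ^ Fintype.card V := by
            refine (Finset.card_le_univ A).trans (le_of_eq ?_)
            rw [Fintype.card_prod, Fintype.card_finset, ← mul_pow]
            norm_num
          exact_mod_cast h1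
  · calc _ ≤ ∑ x ∈ D, Real.exp (-(p₀ / 4 * k)) := by
          refine Finset.sum_le_sum fun x hx => Real.exp_le_exp.2 (neg_le_neg ?_)
          refine mul_le_mul_of_nonneg_left ?_ (by linarith)
          obtain ⟨v, -, rfl⟩ := Finset.mem_image.1 hx
          exact le_card_relPairs_compl hS' hk1 hk v
      _ = D.card * Real.exp (-(p₀ / 4 * k)) := by rw [Finset.sum_const, nsmul_eq_mul]
      _ ≤ _ := by
          refine mul_le_mul_of_nonneg_right ?_ (Real.exp_pos _).le
          exact_mod_cast Finset.card_image_le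

/-! ### Estimates for large n -/

theorem eventually_pow_mul_exp_le (k : ℕ) {c θ : ℝ} (hc : 0 < c) (hθ : 0 < θ) :
    ∀ᶠ n : ℕ in Filter.atTop, (n : ℝ) ^ k * Real.exp (-(c * n)) ≤ θ := by
  have h := tendsto_pow_const_mul_const_pow_of_abs_lt_one k (r := Real.exp (-c)) (by
    rw [abs_of_pos (Real.exp_pos _), Real.exp_lt_one_iff]
    linarith)
  filter_upwards [h.eventually_le_const hθ] with n hn
  have : Real.exp (-(c * n)) = Real.exp (-c) ^ n := by
    rw [← Real.exp_nat_mul]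
    ring_nf
  rwa [this]

theorem eventually_le_mul {a c : ℝ} (hc : 0 < c) : ∀ᶠ n : ℕ in Filter.atTop, a ≤ c * n := by
  have h := (tendsto_natCast_atTop_atTop (R := ℝ)).const_mul_atTop hc
  exact h.eventually_ge_atTop a

theorem eventually_union_bound_le {c d : ℝ} (hc : 0 < c) (hd : 0 < d) :
    ∀ᶠ n : ℕ in Filter.atTop,
      4 ^ n * Real.exp (-(d * n ^ 2)) + n * Real.exp (-(2 * c * n)) ≤ Real.exp (-(c * n)) := by
  filter_upwards [eventually_pow_mul_exp_le 1 hc (θ := 1 / 2) (by norm_num),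
    eventually_le_mul (a := Real.log 4 + c + 1) hd, Filter.eventually_ge_atTop 1] with n h1 h2 hn
  have hn' : (1 : ℝ) ≤ n := by exact_mod_cast hn
  have e1 : n * Real.exp (-(2 * c * n)) ≤ 1 / 2 * Real.exp (-(c * n)) := by
    have : Real.exp (-(2 * c * n)) = Real.exp (-(c * n)) * Real.exp (-(c * n)) := by
      rw [← Real.exp_add]
      ring_nf
    rw [this, ← mul_assoc]
    rw [pow_one] at h1
    exact mul_le_mul_of_nonneg_right h1 (Real.exp_pos _).le
  have e2 : (4 : ℝ) ^ n * Real.exp (-(d * n ^ 2)) ≤ 1 / 2 * Real.exp (-(c * n)) := by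
    have h4 : (4 : ℝ) ^ n = Real.exp (n * Real.log 4) := by
      rw [Real.exp_nat_mul, Real.exp_log (by norm_num)]
    have h3 : Real.exp (-1) ≤ 1 / 2 := by
      have := Real.exp_one_gt_d9
      rw [Real.exp_neg, inv_eq_one_div]
      exact one_div_le_one_div_of_le (by norm_num) (by linarith)
    rw [h4, ← Real.exp_add]
    calc Real.exp (n * Real.log 4 + -(d * n ^ 2)) ≤ Real.exp (-1 + -(c * n)) := by
          rw [Real.exp_le_exp]
          nlinarith
      _ = Real.exp (-1) * Real.exp (-(c * n)) := Real.exp_add _ _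
      _ ≤ _ := mul_le_mul_of_nonneg_right h3 (Real.exp_pos _).le
  linarith

theorem one_add_pow_sub_one_le {y : ℝ} (hy : 0 ≤ y) {n : ℕ} (h : n * y ≤ 1) :
    (1 + y) ^ n - 1 ≤ 2 * (n * y) := by
  have h0 : 0 ≤ n * y := by positivity
  have h1 : (1 + y) ^ n ≤ Real.exp (n * y) := by
    rw [Real.exp_nat_mul, add_comm]
    exact pow_le_pow_left₀ (by linarith) (Real.add_one_le_exp y) n
  have h2 := Real.abs_exp_sub_one_le (x := n * y) (by rwa [abs_of_nonneg h0])
  rw [abs_of_nonneg h0] at h2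
  linarith [le_abs_self (Real.exp (n * y) - 1)]

theorem eventually_failure_le {R : ℕ} (hR : 1 ≤ R) {c θ : ℝ} (hc : 0 < c) (hθ : 0 < θ) :
    ∀ᶠ n : ℕ in Filter.atTop, ∃ η : ℝ,
      R * (2 * ((1 + Real.exp (-(c * n))) ^ n - 1)) ≤ η ∧ 0 ≤ η ∧
        ((Nat.log 2 n + 3 : ℕ) : ℝ) * η ≤ 1 / 4 ∧ η ≤ θ := by
  have hR' : (1 : ℝ) ≤ R := by exact_mod_cast hR
  have hR4 : (0 : ℝ) < 4 * R := by linarith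
  filter_upwards [eventually_pow_mul_exp_le 2 hc (θ := min 1 (min (1 / (64 * R)) (θ / (4 * R))))
    (by positivity), Filter.eventually_ge_atTop 1] with n h1 hn
  have hn' : (1 : ℝ) ≤ n := by exact_mod_cast hn
  set y := Real.exp (-(c * n)) with hy
  have hy0 : 0 < y := Real.exp_pos _
  rw [le_min_iff, le_min_iff, le_div_iff₀ (by linarith), le_div_iff₀ hR4] at h1
  obtain ⟨h1, h2, h3⟩ := h1
  have hny : n * y ≤ n ^ 2 * y := mul_le_mul_of_nonneg_right (by nlinarith) hy0.le
  -- This η comes from (1 + y)^n - 1 ≤ 2ny. The bound on n²y leaves a spare factor n for the number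
  -- of steps.
  refine ⟨4 * R * (n * y), ?_, by positivity, ?_, ?_⟩
  · have := one_add_pow_sub_one_le hy0.le (hny.trans h1)
    nlinarith
  · have ht : ((Nat.log 2 n + 3 : ℕ) : ℝ) ≤ 4 * n := by
      have := Nat.log_le_self 2 n
      exact_mod_cast (by omega : Nat.log 2 n + 3 ≤ 4 * n)
    calc ((Nat.log 2 n + 3 : ℕ) : ℝ) * (4 * R * (n * y)) ≤ 4 * n * (4 * R * (n * y)) :=
          mul_le_mul_of_nonneg_right ht (by positivity)
      _ = n ^ 2 * y * (64 * R) / 4 := by ring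
      _ ≤ _ := by linarith
  · calc 4 * R * (n * y) ≤ 4 * R * (n ^ 2 * y) := mul_le_mul_of_nonneg_left hny hR4.le
      _ ≤ θ := by linarith

/-- Of the extra 3 steps, one compensates for rounding the logarithm down and two give the factor
1/4. -/
theorem half_pow_log_mul_le {n : ℕ} : (1 / 2 : ℝ) ^ (Nat.log 2 n + 3) * n ≤ 1 / 4 := by
  have h := (Nat.lt_pow_succ_log_self (b := 2) one_lt_two n).le
  have h' : (n : ℝ) ≤ 2 ^ (Nat.log 2 n + 1) := by exact_mod_cast h
  have e : (1 / 2 : ℝ) ^ (Nat.log 2 n + 3) * 2 ^ (Nat.log 2 n + 1) = 1 / 4 := by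
    rw [pow_add, pow_add 2, mul_mul_mul_comm, ← mul_pow]
    norm_num
  rw [← e]
  exact mul_le_mul_of_nonneg_left h' (by positivity)

theorem steps_le_log {n : ℕ} (hn : 2 ≤ n) :
    ((1 + (Nat.log 2 n + 3 + (Nat.log 2 n + 3 + 1)) : ℕ) : ℝ) ≤ 20 * Real.log n := by
  have hn0 : (0 : ℝ) < n := by exact_mod_cast (by omega : 0 < n)
  have h2 : Real.log 2 ≤ Real.log n :=
    Real.log_le_log (by norm_num) (by exact_mod_cast hn)
  have hl : (Nat.log 2 n : ℝ) * Real.log 2 ≤ Real.log n := by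
    rw [← Real.log_pow]
    refine Real.log_le_log (by positivity) ?_
    exact_mod_cast Nat.pow_log_le_self 2 (by omega : n ≠ 0)
  have hlog2 : 1 / 2 ≤ Real.log 2 := by linarith [Real.log_two_gt_d9]
  have h0 : (0 : ℝ) ≤ Nat.log 2 n := Nat.cast_nonneg _
  push_cast
  nlinarith

/-! ### Choice of constants and conclusion -/

/-- The mixing bound for one pattern of relevant pairs of parts, with constants that depend only on
the bounds `α₀`, `p₀`, `β₀`. -/
theorem exists_const_graphProb_mixesWithin {α₀ p₀ β₀ : ℝ} (hα₀ : 0 < α₀) (hp₀ : 0 < p₀)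
    (hp₁ : p₀ ≤ 1) (hβ₀ : 0 < β₀) :
    ∃ C c : ℝ, 0 < C ∧ 0 < c ∧
      ∀ (n : ℕ), 2 ≤ n →
      ∀ (r : ℕ) (α : Fin r → ℝ) (p : Sym2 (Fin r) → ℝ) (part : Fin n → Fin r),
        (∀ i, α₀ ≤ α i) → (∑ i, α i = 1) →
        (∀ i, (Fintype.card {v : Fin n // part v = i} : ℝ) = α i * n) →
        (∀ e, 0 ≤ p e ∧ p e ≤ 1) →
        ∀ (ι : Type) [Fintype ι] (blk : Fin r → ι) (S : Sym2 (Fin r) → Prop),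
          BlocksFit S blk → (∀ e, S e → p₀ ≤ p e) →
          1 - Real.exp (-c * n) ≤ graphProb part p (MixesWithin part S β₀ (C * Real.log n)) := by
  classical
  -- R bounds the number of parts. Below, κn is the guaranteed number of favoured spins per part, εn
  -- the degree scale a, and dn the edge expansion of robust sets.
  obtain ⟨R, hRα⟩ := exists_nat_ge (1 / α₀ + 1)
  have hR : 1 ≤ R := by
    have : (0 : ℝ) < 1 / α₀ := by positivity
    exact_mod_cast (by linarith : (1 : ℝ) ≤ R)
  have hR' : (1 : ℝ) ≤ R := by exact_mod_cast hR
  set κ : ℝ := (1 / 2) ^ (R + 1) * min α₀ 1 with hκdef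
  have hκ0 : 0 < κ := by positivity
  have hhalf : (1 / 2 : ℝ) ^ (R + 1) ≤ 1 / 2 :=
    pow_le_of_le_one (by norm_num) (by norm_num) (by omega)
  have hκ1 : κ ≤ 1 := by
    calc κ ≤ 1 / 2 * 1 := mul_le_mul hhalf (min_le_right _ _) (by positivity) (by norm_num)
      _ ≤ 1 := by norm_num
  set ε : ℝ := p₀ * κ / 32 with hε
  have hε0 : 0 < ε := by positivity
  have hε1 : ε ≤ 1 := by
    have : p₀ * κ ≤ 1 := mul_le_one₀ hp₁ hκ0.le hκ1
    linarith
  set d : ℝ := p₀ / 4 * (ε / R) ^ 2 with hd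
  have hd0 : 0 < d := by positivity
  have hdε : d ≤ ε := by
    have h1 : ε / R ≤ ε := div_le_self hε0.le hR'
    have h2 : (ε / R) ^ 2 ≤ ε ^ 2 := pow_le_pow_left₀ (by positivity) h1 2
    have h3 : ε ^ 2 ≤ ε := by nlinarith
    calc d ≤ 1 * (ε / R) ^ 2 :=
          mul_le_mul_of_nonneg_right (by linarith) (by positivity)
      _ ≤ ε := by linarith
  obtain ⟨N, hN⟩ := Filter.eventually_atTop.1 ((eventually_le_mul (a := 1) hε0).and
    ((eventually_failure_le hR (c := 2 * β₀ * d) (θ := (1 / 2) ^ (R + 1)) (by positivity)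
      (by positivity)).and (eventually_union_bound_le (c := p₀ * κ / 8) (by positivity) hd0)))
  have exists_k : ∀ m : ℕ, ∃ k : ℕ, (1 - (1 / 2 : ℝ) ^ m) ^ k ≤ 1 / 4 := fun m => by
    obtain ⟨k, hk⟩ := exists_pow_lt_of_lt_one (y := 1 - (1 / 2 : ℝ) ^ m)
      (by norm_num : (0 : ℝ) < 1 / 4) (by
        have : (0 : ℝ) < (1 / 2) ^ m := by positivity
        linarith)
    exact ⟨k, hk.le⟩
  obtain ⟨K, hK⟩ := exists_k (2 * R + 4)
  obtain ⟨L, hL⟩ := exists_k N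
  -- 20 K serves large n and 2 L serves n < N, where log n ≥ 1/2. The rate is half the exponent of
  -- the star bound, which leaves room for the factor n of the union.
  refine ⟨20 * K + 2 * L + 1, p₀ * κ / 8, by positivity, by positivity, ?_⟩
  intro n hn r α p part hα hαsum hcard hp ι _ blk S hfit hS
  have hlog : 1 / 2 ≤ Real.log n := by
    have h2 : Real.log 2 ≤ Real.log n :=
      Real.log_le_log (by norm_num) (by exact_mod_cast hn)
    linarith [Real.log_two_gt_d9]
  have hn0 : (0 : ℝ) < n := by exact_mod_cast (by omega : 0 < n)
  rcases lt_or_ge n N with hnN | hnN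
  · rw [graphProb_eq_one]
    · linarith [Real.exp_pos (-(p₀ * κ / 8) * n)]
    intro G β γ hβ _ hγ
    obtain ⟨z, hz⟩ := hγ.exists_favours
    obtain ⟨T, hT, hTle⟩ := exists_isMixingTime_le (G := G) (β := β) hβ γ (t := 1) (k := L)
      (q := (1 / 2) ^ N) (ρ := fun _ => z) (fun σ => by
        refine le_trans ?_ (le_transition_const hβ hz σ)
        rw [Fintype.card_fin]
        exact pow_le_pow_of_le_one (by norm_num) (by norm_num) hnN.le) hL
    refine ⟨T, hT, ?_⟩
    have : (T : ℝ) ≤ L := by exact_mod_cast hTle.trans (by omega)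
    have h1 : (0 : ℝ) ≤ K := Nat.cast_nonneg _
    have h2 : (0 : ℝ) ≤ L := Nat.cast_nonneg _
    nlinarith [mul_nonneg h1 (by linarith : 0 ≤ Real.log n),
      mul_nonneg h2 (by linarith : 0 ≤ Real.log n - 1 / 2)]
  obtain ⟨hεn, ⟨η, hη, hη0, htη, hηR⟩, hunion⟩ := hN n hnN
  have hr : r ≤ R := by
    have h1 : (r : ℝ) * α₀ ≤ 1 := by
      rw [← hαsum]
      calc (r : ℝ) * α₀ = ∑ _i : Fin r, α₀ := by simp
        _ ≤ _ := Finset.sum_le_sum fun i _ => hα i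
    rw [← le_div_iff₀ hα₀] at h1
    exact_mod_cast (by linarith : (r : ℝ) ≤ R)
  have hpartcard : ∀ j, min α₀ 1 * n ≤ (Finset.univ.filter fun v => part v = j).card := by
    intro j
    rw [← Fintype.card_subtype, hcard]
    exact mul_le_mul_of_nonneg_right ((min_le_left _ _).trans (hα j)) hn0.le
  have hk : ∀ j, κ * n ≤
      (1 / 2 : ℝ) ^ (R + 1) * (Finset.univ.filter fun v => part v = j).card := by
    intro j
    rw [hκdef, mul_assoc]
    exact mul_le_mul_of_nonneg_left (hpartcard j) (by positivity)
  have hk2 : ∀ j, 2 * (κ * n) ≤ (Finset.univ.filter fun v => part v = j).card := by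
    intro j
    have := mul_le_mul_of_nonneg_right hhalf
      (Nat.cast_nonneg (α := ℝ) (Finset.univ.filter fun v => part v = j).card)
    linarith [hk j]
  have hgood := one_sub_le_graphProb_goodGraph part hp hp₀.le hS hfit.exists_rel
    (m := (ε * n / R) ^ 2) (k := κ * n) (by nlinarith) hk2
  rw [Fintype.card_fin] at hgood
  have e1 : p₀ / 4 * (ε * n / R) ^ 2 = d * n ^ 2 := by rw [hd]; ring
  have e2 : p₀ / 4 * (κ * n) = 2 * (p₀ * κ / 8) * n := by ring
  rw [e1, e2] at hgood
  rw [neg_mul]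
  refine le_trans (by linarith) (hgood.trans (graphProb_mono part hp fun G hG => ?_))
  intro β γ hβ hs hγ
  obtain ⟨z, hz⟩ := hγ.exists_favours
  obtain ⟨T, hT, hTle⟩ := exists_isMixingTime_le (G := G) (β := β) hβ γ
    (t := 1 + (Nat.log 2 n + 3 + (Nat.log 2 n + 3 + 1))) (k := K)
    (q := (1 / 2) ^ (2 * R + 4)) (ρ := fun _ => z)
    (hG.le_pow_transition hfit hr hR hp₀ hp₁ (k := κ * n) (a := ε * n) (κ := d * n) (b := β₀)
      (η := η) (by rw [hε]; ring) hεn hk (by positivity)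
      (mul_le_mul_of_nonneg_right hdε hn0.le)
      (by rw [Fintype.card_fin, e1]; linarith) hβ hβ₀.le hs hz
      (by
        rw [Fintype.card_fin]
        have : -2 * β₀ * (d * n) = -(2 * β₀ * d * n) := by ring
        rwa [this]) hη0 htη hηR (by rw [Fintype.card_fin]; exact half_pow_log_mul_le)) hK
  refine ⟨T, hT, ?_⟩
  have h1 : (T : ℝ) ≤ ((1 + (Nat.log 2 n + 3 + (Nat.log 2 n + 3 + 1)) : ℕ) : ℝ) * K := by
    exact_mod_cast hTle
  have h2 := mul_le_mul_of_nonneg_right (steps_le_log hn) (Nat.cast_nonneg (α := ℝ) K)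
  have h3 : (0 : ℝ) ≤ L * Real.log n := mul_nonneg (Nat.cast_nonneg _) (by linarith)
  nlinarith

theorem blocksFit_id (r : ℕ) : BlocksFit (fun e : Sym2 (Fin r) => e.IsDiag) id where
  surjective := Function.surjective_id
  eq_of_rel _ _ h := Sym2.mk_isDiag_iff.1 h
  rel_of_ne _ _ h hne := absurd h hne
  exists_rel j := ⟨j, Sym2.mk_isDiag_iff.2 rfl⟩

theorem blocksFit_const {r : ℕ} (hr : 2 ≤ r) :
    BlocksFit (fun e : Sym2 (Fin r) => ¬ e.IsDiag) (fun _ => ()) where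
  surjective _ := ⟨⟨0, by omega⟩, rfl⟩
  eq_of_rel _ _ _ := rfl
  rel_of_ne _ _ _ hne := fun h => hne (Sym2.mk_isDiag_iff.1 h)
  exists_rel j := by
    have : Nontrivial (Fin r) := Fin.nontrivial_iff_two_le.2 hr
    obtain ⟨k, hk⟩ := exists_ne j
    exact ⟨k, fun h => hk (Sym2.mk_isDiag_iff.1 h).symm⟩

end SwendsenWang

theorem theorem1 (α₀ p₀ β₀ : ℝ) (hα₀ : 0 < α₀) (hp₀ : 0 < p₀) (hβ₀ : 0 < β₀) :
    ∃ C c : ℝ, 0 < C ∧ 0 < c ∧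
      ∀ (n : ℕ), 2 ≤ n →
      ∀ (r : ℕ) (α : Fin r → ℝ) (p : Sym2 (Fin r) → ℝ) (part : Fin n → Fin r),
        (∀ i, α₀ ≤ α i) → (∑ i, α i = 1) →
        (∀ i, (Fintype.card {v : Fin n // part v = i} : ℝ) = α i * n) →
        (∀ e, 0 ≤ p e ∧ p e ≤ 1) →
        ((∀ i, p₀ ≤ p s(i, i)) →
          1 - Real.exp (-c * n) ≤ SwendsenWang.graphProb part p
            (SwendsenWang.MixesWithin part (fun e => e.IsDiag) β₀ (C * Real.log n))) ∧
        ((2 ≤ r ∧ ∀ i j, i ≠ j → p₀ ≤ p s(i, j)) →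
          1 - Real.exp (-c * n) ≤ SwendsenWang.graphProb part p
            (SwendsenWang.MixesWithin part (fun e => ¬ e.IsDiag) β₀ (C * Real.log n))) := by
  -- The given p₀ may exceed 1, so it is truncated.
  obtain ⟨C, c, hC, hc, h⟩ := SwendsenWang.exists_const_graphProb_mixesWithin hα₀
    (lt_min hp₀ one_pos) (min_le_right p₀ 1) hβ₀
  refine ⟨C, c, hC, hc, fun n hn r α p part hα hαsum hcard hp => ⟨fun hpp => ?_, fun hpp => ?_⟩⟩
  · refine h n hn r α p part hα hαsum hcard hp (Fin r) id _ (SwendsenWang.blocksFit_id r)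
      fun e he => (min_le_left _ _).trans ?_
    induction e with
    | h i j =>
      obtain rfl : i = j := Sym2.mk_isDiag_iff.1 he
      exact hpp i
  · refine h n hn r α p part hα hαsum hcard hp Unit _ _ (SwendsenWang.blocksFit_const hpp.1)
      fun e he => (min_le_left _ _).trans ?_
    induction e with
    | h i j => exact hpp.2 i j fun hij => he (Sym2.mk_isDiag_iff.2 hij)
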